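/- **Theorem (fifth degree homogeneous perturbations of the linear center).** For real $a,b,c$ consider the planar system $$\dot x=-y+a\,y\,x^4,\qquad \dot y=x+b\,x^3y^2+c\,x^5. \tag{CB5}$$ *Conventions.* A cycle is the orbit of a nonconstant periodic solution. An isolated singular point $p$ is a *center* if it has a punctured neighbourhood filled with cycles surrounding $p$. Its *period annulus* is the largest connected neighbourhood of $p$ that is, apart from $p$ itself, covered by cycles surrounding $p$, and the center is *isochronous* if all cycles contained in the period annulus have the same minimal period. Eliminating $y$ from (CB5) near the origin gives the Liénard type equation $\ddot x+f(x)\dot x^2+g(x)=0$ with $$f(x)=\frac{(b+4a)x^3}{1-ax^4},\qquad g(x)=(x+cx^5)(1-ax^4).$$ Put $F(x)=\int_0^x f(s)\,ds$ and $\phi(x)=\int_0^x e^{F(s)}\,ds$, and, for small $x$ (where $xg(x)>0$ for $x\ne0$), let $X(x)$ be the number that has the sign of $x$ and satisfies $\tfrac12X(x)^2=\int_0^x g(s)e^{2F(s)}\,ds$. A *Urabe function* of (CB5) is a function $h$ that is odd and continuous near $0$ and satisfies, for all small $x$, $$\frac{X(x)}{1+h(X(x))}=g(x)e^{F(x)},\qquad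 \phi(x)=X(x)+\int_0^{X(x)}h(t)\,dt,$$ with $1+h(X(x))\neq 0$, and $X(x)\phi(x)>0$ for small $x\ne0$. A *first integral* on an open set $U$ is an analytic function on $U$ which is constant along every solution in $U$ and not constant on any nonempty open subset of $U$. A *linearizing change of coordinates* on an open neighbourhood $U$ of the origin is an injective analytic map $(u,v)$ on $U$ with invertible derivative everywhere, of the form $u=x+\cdots$, $v=y+\cdots$ (dots denote terms of higher order at the origin), which transforms the system into $\dot u=-v$, $\dot v=u$. *Claim.* The origin is an isochronous center of (CB5) if and only if either (i) $b=5a$ and $c=-\tfrac45a$, or (ii) $b=a$ and $c=0$. Moreover, for every $a\in\mathbb R$: * In case (i), the zero function is a Urabe function, and every Urabe function vanishes in a neighbourhood of $0$; $$H=\frac{\big((-5+4ax^4)^2x^2+25y^2\big)^2}{625\,(-1+ax^4)^5}$$ is a first integral on $\{ax^4\neq1\}$; and $$u=\frac{(5-4ax^4)\,x}{5\,(1-ax^4)^{5/4}},\qquad v=\frac{y}{(1-ax^4)^{5/4}}$$ is a linearizing change of coordinates on $\{ax^4<1\}$. * In case (ii), the zero function is a Urabe function, and every Urabe function vanishes in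 a neighbourhood of $0$; $$H=\frac{(x^2+y^2)^2}{-1+ax^4}$$ is a first integral on $\{ax^4\neq1\}$; and $$u=\frac{x}{(1-ax^4)^{1/4}},\qquad v=\frac{y}{(1-ax^4)^{1/4}}$$ is a linearizing change of coordinates on $\{ax^4<1\}$. -/

import Mathlib

open Set Filter Topology

noncomputable section

namespace PlanarSystem

/-- `γ` is (a parametrization of) a cycle of the planar system `q' = V q`, with minimal period
`T`: a `T`-periodic global solution that is injective on a period. -/
structure IsCycle (V : ℝ × ℝ → ℝ × ℝ) (γ : ℝ → ℝ × ℝ) (T : ℝ) : Prop where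
  isIntegralCurve : IsIntegralCurve γ (fun _ => V)
  pos : 0 < T
  periodic : Function.Periodic γ T
  injOn : Set.InjOn γ (Set.Ico 0 T)

/-- The closed curve `γ` surrounds `p`: the point `p` is not on `γ` and lies in a bounded
connected component of the complement of `γ`. -/
def Surrounds (γ : ℝ → ℝ × ℝ) (p : ℝ × ℝ) : Prop :=
  p ∉ Set.range γ ∧ Bornology.IsBounded (connectedComponentIn (Set.range γ)ᶜ p)

/-- The set of all points that lie on a cycle surrounding `p`. -/
def cyclePoints (V : ℝ × ℝ → ℝ × ℝ) (p : ℝ × ℝ) : Set (ℝ × ℝ) :=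
  {q | ∃ γ T, IsCycle V γ T ∧ Surrounds γ p ∧ q ∈ Set.range γ}

/-- `p` is a center: an isolated singular point with a punctured neighbourhood filled with
cycles surrounding `p`. -/
def IsCenter (V : ℝ × ℝ → ℝ × ℝ) (p : ℝ × ℝ) : Prop :=
  V p = 0 ∧ (∀ᶠ q in 𝓝[≠] p, V q ≠ 0) ∧ ∀ᶠ q in 𝓝[≠] p, q ∈ cyclePoints V p

/-- The period annulus of `p` (with `p` itself included): the largest connected set containing
`p` that is, apart from `p`, covered by cycles surrounding `p`. If `p` is a center, then it is a
neighbourhood of `p`. -/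
def periodAnnulus (V : ℝ × ℝ → ℝ × ℝ) (p : ℝ × ℝ) : Set (ℝ × ℝ) :=
  connectedComponentIn (insert p (cyclePoints V p)) p

/-- `p` is an isochronous center: all cycles in its period annulus have the same minimal
period. -/
def IsIsochronousCenter (V : ℝ × ℝ → ℝ × ℝ) (p : ℝ × ℝ) : Prop :=
  IsCenter V p ∧
    ∃ T₀ : ℝ, ∀ γ T, IsCycle V γ T → Set.range γ ⊆ periodAnnulus V p → T = T₀

/-- `H` is an analytic first integral of `q' = V q` on `U`: it is constant along every solution
in `U`, but not constant on any nonempty open subset of `U`. -/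
structure IsFirstIntegralOn (V : ℝ × ℝ → ℝ × ℝ) (H : ℝ × ℝ → ℝ) (U : Set (ℝ × ℝ)) : Prop where
  analytic : AnalyticOnNhd ℝ H U
  nonconstant : ∀ W ⊆ U, IsOpen W → W.Nonempty → ∃ p ∈ W, ∃ q ∈ W, H p ≠ H q
  constant_along : ∀ (γ : ℝ → ℝ × ℝ) (α β : ℝ),
    IsIntegralCurveOn γ (fun _ => V) (Set.Ioo α β) → (∀ t ∈ Set.Ioo α β, γ t ∈ U) →
      ∀ s ∈ Set.Ioo α β, ∀ t ∈ Set.Ioo α β, H (γ s) = H (γ t)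

/-- `Φ = (u, v)` is an analytic change of coordinates on the open neighbourhood `U` of the origin,
of the form `u = x + ⋯`, `v = y + ⋯`, which transforms `q' = V q` into `u' = -v`, `v' = u`. -/
structure IsLinearizationOn (V Φ : ℝ × ℝ → ℝ × ℝ) (U : Set (ℝ × ℝ)) : Prop where
  isOpen : IsOpen U
  zero_mem : (0 : ℝ × ℝ) ∈ U
  analytic : AnalyticOnNhd ℝ Φ U
  injOn : Set.InjOn Φ U
  det_ne_zero : ∀ q ∈ U, (fderiv ℝ Φ q).det ≠ 0
  map_zero : Φ 0 = 0
  fderiv_zero : fderiv ℝ Φ 0 = ContinuousLinearMap.id ℝ (ℝ × ℝ)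
  linear : ∀ q ∈ U, fderiv ℝ Φ q (V q) = (-(Φ q).2, (Φ q).1)

/-- `F(x) = ∫₀ˣ f(s) ds`. -/
def bigF (f : ℝ → ℝ) (x : ℝ) : ℝ := ∫ s in (0 : ℝ)..x, f s

/-- `φ(x) = ∫₀ˣ exp (F(s)) ds`. -/
def phi (f : ℝ → ℝ) (x : ℝ) : ℝ := ∫ s in (0 : ℝ)..x, Real.exp (bigF f s)

/-- The function `X` with `X(x)² / 2 = ∫₀ˣ g(s) exp (2 F(s)) ds` that has the sign of `x`. -/
def bigX (f g : ℝ → ℝ) (x : ℝ) : ℝ :=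
  Real.sign x * Real.sqrt (2 * ∫ s in (0 : ℝ)..x, g s * Real.exp (2 * bigF f s))

/-- `h` is a Urabe function of the Liénard type equation `x'' + f(x) x'² + g(x) = 0`, where
`x g(x) > 0` for small `x ≠ 0`. It is a function near `0`. -/
structure IsUrabeFunction (f g h : ℝ → ℝ) : Prop where
  mul_pos : ∀ᶠ x in 𝓝[≠] (0 : ℝ), 0 < x * g x
  odd : ∀ᶠ t in 𝓝 (0 : ℝ), h (-t) = -h t
  continuousAt : ∀ᶠ t in 𝓝 (0 : ℝ), ContinuousAt h t
  eq_g : ∀ᶠ x in 𝓝 (0 : ℝ), 1 + h (bigX f g x) ≠ 0 ∧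
    bigX f g x / (1 + h (bigX f g x)) = g x * Real.exp (bigF f x)
  eq_phi : ∀ᶠ x in 𝓝 (0 : ℝ), phi f x = bigX f g x + ∫ t in (0 : ℝ)..(bigX f g x), h t
  pos : ∀ᶠ x in 𝓝[≠] (0 : ℝ), 0 < bigX f g x * phi f x

/-- The system `x' = -y + a y x⁴`, `y' = x + b x³ y² + c x⁵`. -/
def cb5 (a b c : ℝ) (q : ℝ × ℝ) : ℝ × ℝ :=
  (-q.2 + a * q.2 * q.1 ^ 4, q.1 + b * q.1 ^ 3 * q.2 ^ 2 + c * q.1 ^ 5)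

/-- The coefficient `f` of the equation `x'' + f(x) x'² + g(x) = 0` which results from `cb5 a b c`
on substituting `y = -x' / (1 - a x⁴)`. -/
def cb5f (a b : ℝ) (x : ℝ) : ℝ := (b + 4 * a) * x ^ 3 / (1 - a * x ^ 4)

/-- The coefficient `g` of the same equation. -/
def cb5g (a c : ℝ) (x : ℝ) : ℝ := (x + c * x ^ 5) * (1 - a * x ^ 4)

/-- `h` is a Urabe function of the system `cb5 a b c`. -/
def IsUrabeFunctionCB5 (a b c : ℝ) (h : ℝ → ℝ) : Prop :=
  IsUrabeFunction (cb5f a b) (cb5g a c) h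

/-- First integral for `b = 5a`, `c = -4a/5`. -/
def firstIntegral₁ (a : ℝ) (q : ℝ × ℝ) : ℝ :=
  ((-5 + 4 * a * q.1 ^ 4) ^ 2 * q.1 ^ 2 + 25 * q.2 ^ 2) ^ 2 / (625 * (-1 + a * q.1 ^ 4) ^ 5)

/-- First integral for `b = a`, `c = 0`. -/
def firstIntegral₂ (a : ℝ) (q : ℝ × ℝ) : ℝ :=
  (q.1 ^ 2 + q.2 ^ 2) ^ 2 / (-1 + a * q.1 ^ 4)

/-- Linearizing coordinates for `b = 5a`, `c = -4a/5`. -/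
def linearization₁ (a : ℝ) (q : ℝ × ℝ) : ℝ × ℝ :=
  ((5 - 4 * a * q.1 ^ 4) * q.1 / (5 * (1 - a * q.1 ^ 4) ^ (5 / 4 : ℝ)),
    q.2 / (1 - a * q.1 ^ 4) ^ (5 / 4 : ℝ))

/-- Linearizing coordinates for `b = a`, `c = 0`. -/
def linearization₂ (a : ℝ) (q : ℝ × ℝ) : ℝ × ℝ :=
  (q.1 / (1 - a * q.1 ^ 4) ^ (1 / 4 : ℝ), q.2 / (1 - a * q.1 ^ 4) ^ (1 / 4 : ℝ))

end PlanarSystem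

end

open PlanarSystem

/-! Sufficiency. Both families are `b = k * a` with `5 * c = (1 - k) * a` and `(k - 5) * a * c = 0`,
for `k = 5` and `k = 1`. On the strip `a x⁴ < 1` the map `u = (x + c x⁵)(1 - a x⁴)^(-k/4)`, `v = y
(1 - a x⁴)^(-k/4)` carries the system to the harmonic oscillator
(`isLinearizationOn_linearization`). The functions `φ`, `X` and `g e^F` all coincide with `u`, which
leaves zero as the only germ of a Urabe function, and `(u² + v²)²` is the first integral up to sign.
Circles pull back to cycles around the origin. The lines `a x⁴ = 1` are invariant, so every cycle
surrounding the origin stays in the strip and has minimal period `2π`.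

Necessity. If all small cycles share the period `T`, the orbit through `(r, 0)`, divided by `r`, is
a closed orbit of a perturbation of the oscillator of size `μ = r⁴`. Suppose near-identity
coordinates reduce the perturbation to `iα μ^m |z|^(2j) z` plus terms of order `μ^(m+1)`. In the
rotating frame the orbit then drifts by `iα μ^m T` to leading order, whereas it must return exactly;
hence `α = 0` (`resonant_coeff_eq_zero`). Order one gives `α = (b - a + 5c)/16`. Once `b = a - 5c`,
order two gives `α = -7c(4a + 5c)/256`. The common zeros are exactly the two families. -/

namespace PlanarSystem

/-! ### The linearizing coordinates -/

/-- The power `(1 - a x⁴) ^ (-k / 4)`. -/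
noncomputable def scale (a k x : ℝ) : ℝ := (1 - a * x ^ 4) ^ (-(k / 4))

/-- The first component of the linearizing change of coordinates. -/
noncomputable def coord (a c k x : ℝ) : ℝ := (x + c * x ^ 5) * scale a k x

/-- The linearizing change of coordinates with parameter `k`. -/
noncomputable def linearization (a c k : ℝ) (q : ℝ × ℝ) : ℝ × ℝ :=
  (coord a c k q.1, q.2 * scale a k q.1)

variable {a b c k x : ℝ}

lemma scale_pos (h : a * x ^ 4 < 1) : 0 < scale a k x :=
  Real.rpow_pos_of_pos (by linarith) _

@[simp] lemma scale_zero_right : scale a k 0 = 1 := by simp [scale]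

@[simp] lemma coord_zero_right : coord a c k 0 = 0 := by simp [coord]

lemma scale_eq_mul (h : a * x ^ 4 < 1) : scale a k x = (1 - a * x ^ 4) * scale a (k + 4) x := by
  have h' : 0 < 1 - a * x ^ 4 := by linarith
  unfold scale
  nth_rewrite 2 [← Real.rpow_one (1 - a * x ^ 4)]
  rw [← Real.rpow_add h']
  congr 1
  ring

lemma hasDerivAt_scale (h : a * x ^ 4 < 1) :
    HasDerivAt (scale a k) (k * a * x ^ 3 * scale a (k + 4) x) x := by
  have h' : 1 - a * x ^ 4 ≠ 0 := by linarith
  have h1 : HasDerivAt (fun x : ℝ => 1 - a * x ^ 4) (-(a * (4 * x ^ 3))) x := by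
    simpa using ((hasDerivAt_pow 4 x).const_mul a).const_sub 1
  refine (h1.rpow_const (p := -(k / 4)) (Or.inl h')).congr_deriv ?_
  have : -(k / 4) - 1 = -((k + 4) / 4) := by ring
  rw [this, scale]
  ring

/-- The product rule leaves the factor `(1 + 5 c x⁴)(1 - a x⁴) + k a x³ (x + c x⁵)`, which has to be
`1`. Its coefficients of `x⁴` and `x⁸` vanish exactly by `hc` and `hk`; for `a ≠ 0` these force `k =
5` or `k = 1`, that is, the two families. -/
lemma hasDerivAt_coord (hc : 5 * c = (1 - k) * a) (hk : (k - 5) * a * c = 0)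
    (h : a * x ^ 4 < 1) : HasDerivAt (coord a c k) (scale a (k + 4) x) x := by
  have h1 : HasDerivAt (fun x : ℝ => x + c * x ^ 5) (1 + c * (5 * x ^ 4)) x := by
    simpa using (hasDerivAt_id' x).fun_add ((hasDerivAt_pow 5 x).const_mul c)
  refine (h1.mul (hasDerivAt_scale h)).congr_deriv ?_
  rw [scale_eq_mul h]
  linear_combination scale a (k + 4) x * (x ^ 4 * hc + x ^ 8 * hk)

lemma analyticAt_scale (h : a * x ^ 4 < 1) : AnalyticAt ℝ (scale a k) x := by
  unfold scale
  have h1 : AnalyticAt ℝ (fun x : ℝ => 1 - a * x ^ 4) x := by fun_prop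
  have h2 : ∀ᶠ y in 𝓝 x, a * y ^ 4 < 1 :=
    (Continuous.tendsto (by fun_prop : Continuous fun y : ℝ => a * y ^ 4) x).eventually_lt_const h
  have h3 : AnalyticAt ℝ (fun x : ℝ => Real.exp (Real.log (1 - a * x ^ 4) * -(k / 4))) x :=
    ((h1.log (by linarith)).mul analyticAt_const).rexp'
  refine h3.congr ?_
  filter_upwards [h2] with y hy
  rw [Real.rpow_def_of_pos (by linarith)]

lemma lt_one_of_abs_le {y : ℝ} (h : a * x ^ 4 < 1) (hy : |y| ≤ |x|) : a * y ^ 4 < 1 := by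
  have h4 : y ^ 4 ≤ x ^ 4 := by
    rw [← Even.pow_abs (by decide : Even 4) y, ← Even.pow_abs (by decide : Even 4) x]
    gcongr
  have h0 : 0 ≤ y ^ 4 := by positivity
  rcases le_total a 0 with ha | ha
  · nlinarith
  · nlinarith

lemma ordConnected_strip (a : ℝ) : OrdConnected {x : ℝ | a * x ^ 4 < 1} := by
  refine ⟨fun x hx y hy z hz => ?_⟩
  rcases le_total |x| |y| with h | h
  · exact lt_one_of_abs_le hy (abs_le_max_abs_abs hz.1 hz.2 |>.trans (max_le h le_rfl))
  · exact lt_one_of_abs_le hx (abs_le_max_abs_abs hz.1 hz.2 |>.trans (max_le le_rfl h))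

lemma isOpen_strip (a : ℝ) : IsOpen {q : ℝ × ℝ | a * q.1 ^ 4 < 1} :=
  isOpen_lt (by fun_prop) (by fun_prop)

lemma strictMonoOn_coord (hc : 5 * c = (1 - k) * a) (hk : (k - 5) * a * c = 0) :
    StrictMonoOn (coord a c k) {x : ℝ | a * x ^ 4 < 1} := by
  refine strictMonoOn_of_deriv_pos (ordConnected_strip a).convex ?_ ?_
  · intro x hx
    exact (hasDerivAt_coord hc hk hx).continuousAt.continuousWithinAt
  · intro x hx
    have hx := interior_subset hx
    rw [(hasDerivAt_coord hc hk hx).deriv]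
    exact scale_pos hx

lemma hasFDerivAt_linearization (hc : 5 * c = (1 - k) * a) (hk : (k - 5) * a * c = 0)
    {q : ℝ × ℝ} (h : a * q.1 ^ 4 < 1) :
    HasFDerivAt (linearization a c k)
      ((scale a (k + 4) q.1 • ContinuousLinearMap.fst ℝ ℝ ℝ).prod
        (q.2 • (k * a * q.1 ^ 3 * scale a (k + 4) q.1) • ContinuousLinearMap.fst ℝ ℝ ℝ +
          scale a k q.1 • ContinuousLinearMap.snd ℝ ℝ ℝ)) q := by
  have h1 := (hasDerivAt_coord hc hk h).comp_hasFDerivAt q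
    (hasFDerivAt_fst (𝕜 := ℝ) (p := q))
  have h2 := (hasDerivAt_scale (k := k) h).comp_hasFDerivAt q
    (hasFDerivAt_fst (𝕜 := ℝ) (p := q))
  exact h1.prodMk ((hasFDerivAt_snd (𝕜 := ℝ) (p := q)).mul h2)

lemma det_lowerTriangular (r s t : ℝ) :
    ((r • ContinuousLinearMap.fst ℝ ℝ ℝ).prod
      (s • ContinuousLinearMap.fst ℝ ℝ ℝ + t • ContinuousLinearMap.snd ℝ ℝ ℝ)).det = r * t := by
  rw [ContinuousLinearMap.det, ← LinearMap.det_toMatrix (Module.Basis.finTwoProd ℝ),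
    Matrix.det_fin_two]
  simp [LinearMap.toMatrix_apply]

/-- Since `x' = -y (1 - a x⁴)`, the derivative `scale a (k + 4)` of `u` becomes `scale a k` along
the flow, so `u' = -v`. In `v'` the term `k a x³ y²` cancels against the derivative of the scale
factor, leaving `u`. For injectivity, `u` is strictly monotone in `x` alone, and `v` then determines
`y`. -/
lemma isLinearizationOn_linearization (hc : 5 * c = (1 - k) * a) (hk : (k - 5) * a * c = 0) :
    IsLinearizationOn (cb5 a (k * a) c) (linearization a c k) {q | a * q.1 ^ 4 < 1} where
  isOpen := isOpen_strip a
  zero_mem := by simp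
  analytic := by
    intro q hq
    have h1 : AnalyticAt ℝ (fun q : ℝ × ℝ => scale a k q.1) q :=
      (analyticAt_scale (k := k) hq).comp analyticAt_fst
    have h2 : AnalyticAt ℝ (fun q : ℝ × ℝ => q.1 + c * q.1 ^ 5) q :=
      analyticAt_fst.add (analyticAt_const.mul (analyticAt_fst.pow 5))
    exact (h2.mul h1).prod (analyticAt_snd.mul h1)
  injOn := by
    rintro ⟨x, y⟩ hq ⟨x', y'⟩ hq' h
    obtain ⟨h1, h2⟩ := Prod.mk.inj h
    obtain rfl : x = x' := (strictMonoOn_coord hc hk).injOn hq hq' h1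
    exact Prod.ext rfl (mul_right_cancel₀ (scale_pos hq).ne' h2)
  det_ne_zero := by
    intro q hq
    rw [(hasFDerivAt_linearization hc hk hq).fderiv, smul_smul, det_lowerTriangular]
    exact (mul_pos (scale_pos hq) (scale_pos hq)).ne'
  map_zero := by simp [linearization]
  fderiv_zero := by
    rw [(hasFDerivAt_linearization hc hk (by simp)).fderiv]
    ext <;> simp
  linear := by
    intro q hq
    rw [(hasFDerivAt_linearization hc hk hq).fderiv]
    ext
    · simp only [linearization, cb5, ContinuousLinearMap.prod_apply, _root_.smul_apply,
        ContinuousLinearMap.coe_fst', smul_eq_mul]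
      rw [scale_eq_mul (k := k) hq]
      ring
    · simp only [linearization, cb5, coord, ContinuousLinearMap.prod_apply,
        _root_.smul_apply, _root_.add_apply,
        ContinuousLinearMap.coe_fst', ContinuousLinearMap.coe_snd', smul_eq_mul]
      rw [scale_eq_mul (k := k) hq]
      ring

lemma IsLinearizationOn.congr {V Φ Ψ : ℝ × ℝ → ℝ × ℝ} {U : Set (ℝ × ℝ)}
    (h : IsLinearizationOn V Φ U) (hΨ : EqOn Ψ Φ U) : IsLinearizationOn V Ψ U := by
  have hd : ∀ q ∈ U, fderiv ℝ Ψ q = fderiv ℝ Φ q := fun q hq =>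
    (hΨ.eventuallyEq_of_mem (h.isOpen.mem_nhds hq)).fderiv_eq
  refine ⟨h.isOpen, h.zero_mem, h.analytic.congr h.isOpen hΨ.symm, h.injOn.congr hΨ.symm,
    fun q hq => ?_, ?_, ?_, fun q hq => ?_⟩
  · rw [hd q hq]; exact h.det_ne_zero q hq
  · rw [hΨ h.zero_mem, h.map_zero]
  · rw [hd 0 h.zero_mem, h.fderiv_zero]
  · rw [hd q hq, hΨ hq, h.linear q hq]

lemma isLinearizationOn_linearization₁ (a : ℝ) :
    IsLinearizationOn (cb5 a (5 * a) (-(4 / 5) * a)) (linearization₁ a) {q | a * q.1 ^ 4 < 1} := by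
  refine (isLinearizationOn_linearization (k := 5) (by ring) (by ring)).congr fun q hq => ?_
  have h : (0 : ℝ) < 1 - a * q.1 ^ 4 := by simp at hq; linarith
  have h' := Real.rpow_pos_of_pos h (5 / 4)
  simp only [linearization, linearization₁, coord, scale, Real.rpow_neg h.le, Prod.mk.injEq]
  constructor <;> field_simp
  ring

lemma isLinearizationOn_linearization₂ (a : ℝ) :
    IsLinearizationOn (cb5 a a 0) (linearization₂ a) {q | a * q.1 ^ 4 < 1} := by
  have := isLinearizationOn_linearization (a := a) (c := 0) (k := 1) (by ring) (by ring)
  rw [one_mul] at this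
  refine this.congr fun q hq => ?_
  have h : (0 : ℝ) < 1 - a * q.1 ^ 4 := by simp at hq; linarith
  have h' := Real.rpow_pos_of_pos h (1 / 4)
  simp only [linearization, linearization₂, coord, scale, Real.rpow_neg h.le, Prod.mk.injEq]
  constructor <;> field_simp
  ring

end PlanarSystem

/-! ### Urabe functions and first integrals -/

namespace PlanarSystem

variable {a b c k x : ℝ}

lemma lt_one_of_mem_uIcc {s : ℝ} (h : a * x ^ 4 < 1) (hs : s ∈ uIcc 0 x) : a * s ^ 4 < 1 :=
  (ordConnected_strip a).uIcc_subset (by simp) h hs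

lemma eventually_strip (a : ℝ) : ∀ᶠ x in 𝓝 (0 : ℝ), a * x ^ 4 < 1 :=
  (Continuous.tendsto (by fun_prop : Continuous fun y : ℝ => a * y ^ 4) 0).eventually_lt_const
    (by simp)

lemma integral_eq_of_hasDerivAt_strip {G G' : ℝ → ℝ} (h : a * x ^ 4 < 1)
    (hG : ∀ s, a * s ^ 4 < 1 → HasDerivAt G (G' s) s)
    (hG' : ∀ s, a * s ^ 4 < 1 → ContinuousAt G' s) : ∫ s in (0 : ℝ)..x, G' s = G x - G 0 :=
  intervalIntegral.integral_eq_sub_of_hasDerivAt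
    (fun s hs => hG s (lt_one_of_mem_uIcc h hs))
    (ContinuousOn.intervalIntegrable
      fun s hs => (hG' s (lt_one_of_mem_uIcc h hs)).continuousWithinAt)

/-- For `b = k * a`, `f` is a multiple of the logarithmic derivative of `1 - a x⁴`. Hence `e^F` is
the derivative of `coord`, from which `phi`, `g e^F` and `bigX` are all identified with `coord`. -/
lemma exp_bigF (h : a * x ^ 4 < 1) : Real.exp (bigF (cb5f a (k * a)) x) = scale a (k + 4) x := by
  have key : bigF (cb5f a (k * a)) x =
      -((k + 4) / 4) * Real.log (1 - a * x ^ 4) - -((k + 4) / 4) * Real.log (1 - a * 0 ^ 4) := by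
    refine integral_eq_of_hasDerivAt_strip
      (G := fun x => -((k + 4) / 4) * Real.log (1 - a * x ^ 4)) h ?_ ?_
    · intro s hs
      have hs : 1 - a * s ^ 4 ≠ 0 := by linarith
      have h1 : HasDerivAt (fun x : ℝ => 1 - a * x ^ 4) (-(a * (4 * s ^ 3))) s := by
        simpa using ((hasDerivAt_pow 4 s).const_mul a).const_sub 1
      refine ((h1.log hs).const_mul (-((k + 4) / 4))).congr_deriv ?_
      unfold cb5f
      field_simp
    · intro s hs
      have hs : 1 - a * s ^ 4 ≠ 0 := by linarith
      unfold cb5f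
      fun_prop (disch := assumption)
  rw [key, scale, Real.rpow_def_of_pos (by linarith)]
  simp [mul_comm]

lemma continuousAt_scale (h : a * x ^ 4 < 1) : ContinuousAt (scale a k) x :=
  (hasDerivAt_scale h).continuousAt

lemma integral_congr_strip {G G' : ℝ → ℝ} (h : a * x ^ 4 < 1)
    (hG : ∀ s, a * s ^ 4 < 1 → G s = G' s) :
    ∫ s in (0 : ℝ)..x, G s = ∫ s in (0 : ℝ)..x, G' s :=
  intervalIntegral.integral_congr fun s hs => hG s (lt_one_of_mem_uIcc h hs)

lemma phi_eq_coord (hc : 5 * c = (1 - k) * a) (hk : (k - 5) * a * c = 0) (h : a * x ^ 4 < 1) :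
    phi (cb5f a (k * a)) x = coord a c k x := by
  unfold phi
  rw [integral_congr_strip h (fun s hs => exp_bigF hs),
    integral_eq_of_hasDerivAt_strip h (fun s hs => hasDerivAt_coord hc hk hs)
      (fun s hs => continuousAt_scale hs)]
  simp

lemma cb5g_mul_exp_bigF (h : a * x ^ 4 < 1) :
    cb5g a c x * Real.exp (bigF (cb5f a (k * a)) x) = coord a c k x := by
  rw [exp_bigF h, coord, cb5g, scale_eq_mul (k := k) h]
  ring

lemma mul_coord_pos (hc : 5 * c = (1 - k) * a) (hk : (k - 5) * a * c = 0) (h : a * x ^ 4 < 1)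
    (hx : x ≠ 0) : 0 < x * coord a c k x := by
  have h0 : (0 : ℝ) ∈ {x : ℝ | a * x ^ 4 < 1} := by simp
  rcases hx.lt_or_gt with hx | hx
  · have := strictMonoOn_coord hc hk h h0 hx
    rw [coord_zero_right] at this
    exact mul_pos_of_neg_of_neg hx this
  · have := strictMonoOn_coord hc hk h0 h hx
    rw [coord_zero_right] at this
    exact mul_pos hx this

/-- The integrand `g e^(2F)` is `coord` times its own derivative, so the integral is `coord² / 2`;
`coord` has the sign of `x`, which selects the right square root. -/
lemma bigX_eq_coord (hc : 5 * c = (1 - k) * a) (hk : (k - 5) * a * c = 0) (h : a * x ^ 4 < 1) :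
    bigX (cb5f a (k * a)) (cb5g a c) x = coord a c k x := by
  have key : ∫ s in (0 : ℝ)..x, cb5g a c s * Real.exp (2 * bigF (cb5f a (k * a)) s) =
      coord a c k x ^ 2 / 2 := by
    rw [integral_congr_strip (G' := fun s => coord a c k s * scale a (k + 4) s) h,
      integral_eq_of_hasDerivAt_strip (G := fun s => coord a c k s ^ 2 / 2) h]
    · simp
    · intro s hs
      refine (((hasDerivAt_coord hc hk hs).pow 2).div_const 2).congr_deriv ?_
      push_cast
      ring
    · exact fun s hs => (hasDerivAt_coord hc hk hs).continuousAt.mul (continuousAt_scale hs)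
    · intro s hs
      rw [two_mul, Real.exp_add, ← mul_assoc, cb5g_mul_exp_bigF hs, exp_bigF hs]
  unfold bigX
  rw [key, mul_div_cancel₀ _ two_ne_zero, Real.sqrt_sq_eq_abs]
  rcases lt_trichotomy x 0 with hx | rfl | hx
  · have := mul_coord_pos hc hk h hx.ne
    rw [Real.sign_of_neg hx, abs_of_neg (neg_of_mul_pos_right this hx.le)]
    ring
  · simp
  · have := mul_coord_pos hc hk h hx.ne'
    rw [Real.sign_of_pos hx, abs_of_pos (pos_of_mul_pos_right this hx.le), one_mul]

lemma isUrabeFunctionCB5_zero (hc : 5 * c = (1 - k) * a) (hk : (k - 5) * a * c = 0) :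
    IsUrabeFunctionCB5 a (k * a) c (fun _ => 0) where
  mul_pos := by
    filter_upwards [(eventually_strip a).filter_mono nhdsWithin_le_nhds, self_mem_nhdsWithin]
      with x hx hx0
    have := mul_coord_pos hc hk hx hx0
    rw [← cb5g_mul_exp_bigF hx, ← mul_assoc] at this
    exact pos_of_mul_pos_left this (Real.exp_pos _).le
  odd := by simp
  continuousAt := Eventually.of_forall fun t => continuousAt_const
  eq_g := by
    filter_upwards [eventually_strip a] with x hx
    simp [bigX_eq_coord hc hk hx, cb5g_mul_exp_bigF hx]
  eq_phi := by
    filter_upwards [eventually_strip a] with x hx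
    simp [bigX_eq_coord hc hk hx, phi_eq_coord hc hk hx]
  pos := by
    filter_upwards [(eventually_strip a).filter_mono nhdsWithin_le_nhds, self_mem_nhdsWithin]
      with x hx hx0
    rw [bigX_eq_coord hc hk hx, phi_eq_coord hc hk hx]
    exact mul_self_pos.2 (right_ne_zero_of_mul (mul_coord_pos hc hk hx hx0).ne')

/-- Turns a statement about `h (coord x)` for small `x` into one about `h t` for every small `t`. -/
lemma map_coord_nhds_zero (hc : 5 * c = (1 - k) * a) (hk : (k - 5) * a * c = 0) :
    map (coord a c k) (𝓝 0) = 𝓝 0 := by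
  have h0 : a * (0 : ℝ) ^ 4 < 1 := by simp
  have h1 : AnalyticAt ℝ (coord a c k) 0 :=
    (by fun_prop : AnalyticAt ℝ (fun x : ℝ => x + c * x ^ 5) 0).mul (analyticAt_scale h0)
  have h2 := h1.hasStrictDerivAt
  rw [(hasDerivAt_coord hc hk h0).deriv] at h2
  simpa using h2.map_nhds_eq (scale_pos h0).ne'

lemma eventually_eq_zero_of_isUrabeFunctionCB5 (hc : 5 * c = (1 - k) * a)
    (hk : (k - 5) * a * c = 0) {h : ℝ → ℝ} (hh : IsUrabeFunctionCB5 a (k * a) c h) :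
    ∀ᶠ t in 𝓝 (0 : ℝ), h t = 0 := by
  rw [← map_coord_nhds_zero hc hk, eventually_map]
  filter_upwards [hh.eq_g, eventually_strip a] with x hg hx
  rw [bigX_eq_coord hc hk hx, cb5g_mul_exp_bigF hx] at hg
  rcases eq_or_ne x 0 with rfl | hx0
  · have := hh.odd.self_of_nhds
    rw [neg_zero] at this
    rw [coord_zero_right]
    linarith
  · have h1 := right_ne_zero_of_mul (mul_coord_pos hc hk hx hx0).ne'
    rw [div_eq_iff hg.1] at hg
    simpa [mul_add, h1] using hg.2

/-- A common form of the two first integrals. -/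
noncomputable def firstIntegral (a c : ℝ) (n : ℕ) (q : ℝ × ℝ) : ℝ :=
  ((q.1 + c * q.1 ^ 5) ^ 2 + q.2 ^ 2) ^ 2 / (-1 + a * q.1 ^ 4) ^ n

/-- A vertical move away from the `x`-axis keeps the denominator of `firstIntegral` and strictly
increases its numerator. -/
lemma exists_mem_ne_of_isOpen {W : Set (ℝ × ℝ)} (hW : IsOpen W) {q : ℝ × ℝ} (hq : q ∈ W) :
    ∃ y, (q.1, y) ∈ W ∧ q.2 ^ 2 < y ^ 2 := by
  have h : ∀ᶠ ε in 𝓝[>] (0 : ℝ), (q.1, q.2 + ε) ∈ W ∧ (q.1, q.2 - ε) ∈ W := by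
    refine nhdsWithin_le_nhds (Filter.Eventually.and ?_ ?_) <;>
    exact (Continuous.tendsto (by fun_prop) (0 : ℝ)).eventually (hW.mem_nhds (by simpa using hq))
  obtain ⟨ε, ⟨h1, h2⟩, hε⟩ := (h.and self_mem_nhdsWithin).exists
  replace hε : 0 < ε := hε
  rcases le_total 0 q.2 with h0 | h0
  · exact ⟨_, h1, by nlinarith⟩
  · exact ⟨_, h2, by nlinarith⟩

lemma IsIntegralCurveOn.hasDerivAt_cb5 {γ : ℝ → ℝ × ℝ} {α β t : ℝ}
    (h : IsIntegralCurveOn γ (fun _ => cb5 a b c) (Ioo α β)) (ht : t ∈ Ioo α β) :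
    HasDerivAt (fun t => (γ t).1) (cb5 a b c (γ t)).1 t ∧
      HasDerivAt (fun t => (γ t).2) (cb5 a b c (γ t)).2 t := by
  have := (h t ht).hasDerivAt (isOpen_Ioo.mem_nhds ht)
  exact ⟨this.fst, this.snd⟩

/-- On the strip this function is `±(u² + v²)²`. The natural exponent makes it rational, so the same
computation works beyond the lines `a x⁴ = 1`. -/
lemma isFirstIntegralOn_firstIntegral {n : ℕ} (hn : n ≠ 0) (hc : 5 * c = (1 - n) * a)
    (hk : (n - 5) * a * c = 0) :
    IsFirstIntegralOn (cb5 a (n * a) c) (firstIntegral a c n) {q | a * q.1 ^ 4 ≠ 1} where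
  analytic := by
    intro q hq
    have h1 : AnalyticAt ℝ (fun q : ℝ × ℝ => q.1) q := analyticAt_fst
    have h2 : AnalyticAt ℝ (fun q : ℝ × ℝ => q.2) q := analyticAt_snd
    refine ((((h1.add (analyticAt_const.mul (h1.pow 5))).pow 2).add (h2.pow 2)).pow 2).div
      ((analyticAt_const.add (analyticAt_const.mul (h1.pow 4))).pow n) (pow_ne_zero n ?_)
    exact fun h : -1 + a * q.1 ^ 4 = 0 => hq (by linarith)
  nonconstant := by
    rintro W hWU hW ⟨q, hq⟩
    obtain ⟨y, hy, hlt⟩ := exists_mem_ne_of_isOpen hW hq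
    refine ⟨q, hq, (q.1, y), hy, fun h => ?_⟩
    have hD : (-1 + a * q.1 ^ 4) ^ n ≠ 0 := pow_ne_zero n fun h => hWU hq (by linarith)
    have := (div_left_inj' hD).1 h
    have := (sq_eq_sq₀ (by positivity) (by positivity)).1 this
    simp only at this
    linarith
  constant_along := by
    intro γ α β hγ hU s hs t ht
    have key : ∀ t ∈ Ioo α β, HasDerivAt (fun t => firstIntegral a c n (γ t)) 0 t := by
      intro t ht
      obtain ⟨hX, hY⟩ := IsIntegralCurveOn.hasDerivAt_cb5 hγ ht
      have hD0 : -1 + a * (γ t).1 ^ 4 ≠ 0 := fun h => hU t ht (by linarith)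
      have hN := ((hX.fun_add ((hX.fun_pow 5).const_mul c)).fun_pow 2).fun_add (hY.fun_pow 2)
      have hD := ((hX.fun_pow 4).const_mul a).const_add (-1)
      refine ((hN.fun_pow 2).fun_div (hD.fun_pow n) (pow_ne_zero n hD0)).congr_deriv ?_
      rw [div_eq_zero_iff]
      left
      obtain ⟨m, rfl⟩ := Nat.exists_eq_succ_of_ne_zero hn
      simp only [cb5, Nat.succ_eq_add_one, Nat.add_sub_cancel, Nat.cast_add, Nat.cast_one] at hc hk ⊢
      generalize (γ t).1 = X
      generalize (γ t).2 = Y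
      push_cast
      -- The numerator of the derivative contains the factor of `hasDerivAt_coord` minus `1`, which
      -- is `x⁴ (hc + x⁴ hk)`.
      linear_combination (-4 * Y * X ^ 5 * (1 + c * X ^ 4) *
        ((X + c * X ^ 5) ^ 2 + Y ^ 2) * (-1 + a * X ^ 4) ^ m * (-1 + a * X ^ 4)) *
          (hc + X ^ 4 * hk)
    exact isOpen_Ioo.is_const_of_deriv_eq_zero isPreconnected_Ioo
      (fun t ht => (key t ht).differentiableAt.differentiableWithinAt)
      (fun t ht => (key t ht).deriv) hs ht

lemma firstIntegral₁_eq (a : ℝ) : firstIntegral₁ a = firstIntegral a (-(4 / 5) * a) 5 := by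
  ext q
  rw [firstIntegral₁, firstIntegral, ← mul_div_mul_left _ (_ ^ 5) (by norm_num : (625 : ℝ) ≠ 0)]
  congr 1
  ring

lemma firstIntegral₂_eq (a : ℝ) : firstIntegral₂ a = firstIntegral a 0 1 := by
  ext q
  simp [firstIntegral₂, firstIntegral]

end PlanarSystem

/-! ### A linearization yields an isochronous center -/

namespace PlanarSystem

/-- The rotation of the plane by the angle `t`, applied to `p`. -/
noncomputable def rot (p : ℝ × ℝ) (t : ℝ) : ℝ × ℝ :=
  (p.1 * Real.cos t - p.2 * Real.sin t, p.1 * Real.sin t + p.2 * Real.cos t)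

@[simp] lemma rot_zero (p : ℝ × ℝ) : rot p 0 = p := by simp [rot]

lemma rot_two_pi (p : ℝ × ℝ) : rot p (2 * Real.pi) = p := by simp [rot]

lemma rot_periodic (p : ℝ × ℝ) : Function.Periodic (rot p) (2 * Real.pi) := by
  intro t
  simp [rot]

lemma rot_sq_add_sq (p : ℝ × ℝ) (t : ℝ) : (rot p t).1 ^ 2 + (rot p t).2 ^ 2 = p.1 ^ 2 + p.2 ^ 2 := by
  simp only [rot]
  linear_combination (p.1 ^ 2 + p.2 ^ 2) * Real.sin_sq_add_cos_sq t

lemma hasDerivAt_rot (p : ℝ × ℝ) (t : ℝ) : HasDerivAt (rot p) (-(rot p t).2, (rot p t).1) t := by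
  have hs := Real.hasDerivAt_sin t
  have hc := Real.hasDerivAt_cos t
  refine (((hc.const_mul p.1).sub (hs.const_mul p.2)).prodMk
    ((hs.const_mul p.1).add (hc.const_mul p.2))).congr_deriv ?_
  ext <;> simp only [rot] <;> ring

lemma sq_add_sq_pos {p : ℝ × ℝ} (hp : p ≠ 0) : 0 < p.1 ^ 2 + p.2 ^ 2 := by
  have : p.1 ≠ 0 ∨ p.2 ≠ 0 := by
    by_contra! h
    exact hp (Prod.ext h.1 h.2)
  rcases this with h | h <;> positivity

lemma exists_int_of_rot_eq {p : ℝ × ℝ} (hp : p ≠ 0) {s t : ℝ} (h : rot p s = rot p t) :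
    ∃ n : ℤ, s - t = 2 * Real.pi * n := by
  have h0 := (sq_add_sq_pos hp).ne'
  obtain ⟨h1, h2⟩ := Prod.mk.inj h
  have hc : Real.cos s = Real.cos t := by
    apply mul_left_cancel₀ h0
    linear_combination p.1 * h1 + p.2 * h2
  have hs : Real.sin s = Real.sin t := by
    apply mul_left_cancel₀ h0
    linear_combination p.1 * h2 - p.2 * h1
  exact Real.Angle.angle_eq_iff_two_pi_dvd_sub.1 (Real.Angle.cos_sin_inj hc hs)

lemma injOn_rot {p : ℝ × ℝ} (hp : p ≠ 0) : InjOn (rot p) (Ico 0 (2 * Real.pi)) := by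
  intro s hs t ht h
  obtain ⟨n, hn⟩ := exists_int_of_rot_eq hp h
  have hpi := Real.two_pi_pos
  have h1 : (n : ℝ) < 1 := by
    by_contra! h
    nlinarith [hs.2, ht.1]
  have h2 : (-1 : ℝ) < n := by
    by_contra! h
    nlinarith [hs.1, ht.2]
  have h3 : n = 0 := by
    have h1 : n < 1 := by exact_mod_cast h1
    have h2 : -1 < n := by exact_mod_cast h2
    omega
  rw [h3] at hn
  simpa [sub_eq_zero] using hn

lemma exists_rot_eq {p q : ℝ × ℝ} (hp : p ≠ 0) (h : q.1 ^ 2 + q.2 ^ 2 = p.1 ^ 2 + p.2 ^ 2) :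
    ∃ t, rot p t = q := by
  have h0 := (sq_add_sq_pos hp).ne'
  set r := p.1 ^ 2 + p.2 ^ 2 with hr
  -- This complex number is the quotient `q / p`; its argument is the required angle.
  have hz : ‖(⟨(p.1 * q.1 + p.2 * q.2) / r, (p.1 * q.2 - p.2 * q.1) / r⟩ : ℂ)‖ = 1 := by
    rw [← sq_eq_sq₀ (norm_nonneg _) zero_le_one, ← Complex.normSq_eq_norm_sq, Complex.normSq_mk]
    field_simp
    rw [hr]
    linear_combination (p.1 ^ 2 + p.2 ^ 2) * h
  obtain ⟨t, ht⟩ := (Complex.norm_eq_one_iff _).1 hz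
  rw [Complex.exp_mul_I] at ht
  have h1 := congrArg Complex.re ht
  have h2 := congrArg Complex.im ht
  simp [← Complex.ofReal_cos, ← Complex.ofReal_sin] at h1 h2
  refine ⟨t, ?_⟩
  ext
  · simp only [rot, h1, h2]
    field_simp
    rw [hr]
    ring
  · simp only [rot, h1, h2]
    field_simp
    rw [hr]
    ring

lemma hasDerivAt_components {P : ℝ → ℝ × ℝ} {p : ℝ × ℝ} {t : ℝ} (h : HasDerivAt P p t) :
    HasDerivAt (fun t => (P t).1) p.1 t ∧ HasDerivAt (fun t => (P t).2) p.2 t :=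
  ⟨h.fst, h.snd⟩

/-- A solution of the linear system `u' = -v`, `v' = u` is a rotation. -/
lemma eq_rot_of_hasDerivAt {P : ℝ → ℝ × ℝ} (hP : ∀ t, HasDerivAt P (-(P t).2, (P t).1) t) (t : ℝ) :
    P t = rot (P 0) t := by
  -- Rotating `P t` back by the angle `t` gives a constant vector; `h1` and `h2` are its components.
  have h1 : ∀ t, HasDerivAt (fun t => (P t).1 * Real.cos t + (P t).2 * Real.sin t) 0 t := by
    intro t
    refine (((hasDerivAt_components (hP t)).1.mul (Real.hasDerivAt_cos t)).add
      ((hasDerivAt_components (hP t)).2.mul (Real.hasDerivAt_sin t))).congr_deriv ?_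
    ring
  have h2 : ∀ t, HasDerivAt (fun t => (P t).2 * Real.cos t - (P t).1 * Real.sin t) 0 t := by
    intro t
    refine (((hasDerivAt_components (hP t)).2.mul (Real.hasDerivAt_cos t)).sub
      ((hasDerivAt_components (hP t)).1.mul (Real.hasDerivAt_sin t))).congr_deriv ?_
    ring
  have e1 := is_const_of_deriv_eq_zero (fun t => (h1 t).differentiableAt) (fun t => (h1 t).deriv) t 0
  have e2 := is_const_of_deriv_eq_zero (fun t => (h2 t).differentiableAt) (fun t => (h2 t).deriv) t 0
  simp only [Real.cos_zero, Real.sin_zero, mul_one, mul_zero, add_zero, sub_zero] at e1 e2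
  have h3 := Real.sin_sq_add_cos_sq t
  ext
  · simp only [rot, ← e1, ← e2]
    linear_combination (-(P t).1) * h3
  · simp only [rot, ← e1, ← e2]
    linear_combination (-(P t).2) * h3

variable {V Φ : ℝ × ℝ → ℝ × ℝ} {U : Set (ℝ × ℝ)}

lemma IsLinearizationOn.ne_zero (h : IsLinearizationOn V Φ U) {q : ℝ × ℝ} (hq : q ∈ U)
    (h0 : q ≠ 0) : Φ q ≠ 0 := fun hΦ =>
  h0 (h.injOn hq h.zero_mem (hΦ.trans h.map_zero.symm))

/-- A cycle in the domain of a linearization has minimal period `2π`. -/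
lemma IsLinearizationOn.period_eq (h : IsLinearizationOn V Φ U) {γ : ℝ → ℝ × ℝ} {T : ℝ}
    (hγ : IsCycle V γ T) (hU : ∀ t, γ t ∈ U) : T = 2 * Real.pi := by
  have hpi := Real.two_pi_pos
  have hP : ∀ t, HasDerivAt (Φ ∘ γ) (-((Φ ∘ γ) t).2, ((Φ ∘ γ) t).1) t := by
    intro t
    refine ((h.analytic _ (hU t)).differentiableAt.hasFDerivAt.comp_hasDerivAt t
      (hγ.isIntegralCurve t)).congr_deriv ?_
    exact h.linear _ (hU t)
  have hrot := eq_rot_of_hasDerivAt hP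
  -- The image curve closes up after `2π`, so by injectivity `γ` does too. Conversely `T` is a
  -- positive multiple of `2π`, because the image is a rotation of a nonzero point.
  have hle : T ≤ 2 * Real.pi := by
    by_contra! hlt
    have h1 : (Φ ∘ γ) (2 * Real.pi) = (Φ ∘ γ) 0 := by rw [hrot, rot_two_pi]
    exact hpi.ne' (hγ.injOn ⟨hpi.le, hlt⟩ ⟨le_rfl, hγ.pos⟩ (h.injOn (hU _) (hU _) h1))
  have h0 : (Φ ∘ γ) 0 ≠ 0 := by
    intro h0
    have h1 : (Φ ∘ γ) (T / 2) = (Φ ∘ γ) 0 := by rw [hrot, h0]; simp [rot]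
    have hT := hγ.pos
    have := hγ.injOn ⟨by linarith, by linarith⟩ ⟨le_rfl, hγ.pos⟩ (h.injOn (hU _) (hU _) h1)
    linarith
  have hT : (Φ ∘ γ) T = (Φ ∘ γ) 0 := by
    have := hγ.periodic 0
    rw [zero_add] at this
    rw [Function.comp_apply, this, Function.comp_apply]
  rw [hrot T] at hT
  obtain ⟨n, hn⟩ := exists_int_of_rot_eq h0 (hT.trans (rot_zero _).symm)
  rw [sub_zero] at hn
  have hn0 : (0 : ℝ) < n := by
    have := hγ.pos
    rw [hn] at this
    exact pos_of_mul_pos_right this hpi.le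
  have hn1 : (1 : ℝ) ≤ n := by
    have : 0 < n := by exact_mod_cast hn0
    exact_mod_cast this
  nlinarith

lemma isCompact_disc (r : ℝ) : IsCompact {p : ℝ × ℝ | p.1 ^ 2 + p.2 ^ 2 ≤ r} := by
  refine Metric.isCompact_of_isClosed_isBounded (isClosed_le (by fun_prop) (by fun_prop)) ?_
  refine (Metric.isBounded_closedBall (x := (0 : ℝ × ℝ)) (r := √r)).subset fun p hp => ?_
  have hp : p.1 ^ 2 + p.2 ^ 2 ≤ r := hp
  rw [mem_closedBall_zero_iff, Prod.norm_def, max_le_iff]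
  constructor <;> apply Real.abs_le_sqrt <;> nlinarith [sq_nonneg p.1, sq_nonneg p.2]

lemma exists_disc_subset {s : Set (ℝ × ℝ)} (hs : s ∈ 𝓝 0) :
    ∃ r > 0, {p : ℝ × ℝ | p.1 ^ 2 + p.2 ^ 2 < r} ⊆ s := by
  obtain ⟨ε, hε, h⟩ := Metric.mem_nhds_iff.1 hs
  refine ⟨ε ^ 2, by positivity, fun p hp => h ?_⟩
  have hp : p.1 ^ 2 + p.2 ^ 2 < ε ^ 2 := hp
  rw [mem_ball_zero_iff, Prod.norm_def, max_lt_iff]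
  constructor <;> apply abs_lt_of_sq_lt_sq _ hε.le <;> nlinarith [sq_nonneg p.1, sq_nonneg p.2]

/-- The preimage of a circle under a local homeomorphism surrounds the preimage of its center. -/
lemma surrounds_symm_rot (e : OpenPartialHomeomorph (ℝ × ℝ) (ℝ × ℝ)) (h0 : (0 : ℝ × ℝ) ∈ e.source)
    (he : e 0 = 0) {p : ℝ × ℝ} (hp : p ≠ 0)
    (ht : {q : ℝ × ℝ | q.1 ^ 2 + q.2 ^ 2 ≤ p.1 ^ 2 + p.2 ^ 2} ⊆ e.target) :
    Surrounds (fun t => e.symm (rot p t)) 0 := by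
  have hpos := sq_add_sq_pos hp
  have hnot : (0 : ℝ × ℝ) ∉ range fun t => e.symm (rot p t) := by
    rintro ⟨t, h⟩
    have h1 : rot p t ∈ e.target := ht (rot_sq_add_sq p t).le
    have h2 : rot p t = 0 := by 
      rw [← e.right_inv h1, show e.symm (rot p t) = 0 from h, he]
    have h3 := rot_sq_add_sq p t
    rw [h2] at h3
    simp at h3
    linarith
  refine ⟨hnot, ?_⟩
  set K := {q : ℝ × ℝ | q.1 ^ 2 + q.2 ^ 2 ≤ p.1 ^ 2 + p.2 ^ 2}
  have hK : IsCompact (e.symm '' K) :=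
    (isCompact_disc _).image_of_continuousOn (e.continuousOn_symm.mono ht)
  refine hK.isBounded.subset ?_
  set A := e.source ∩ e ⁻¹' {q : ℝ × ℝ | q.1 ^ 2 + q.2 ^ 2 < p.1 ^ 2 + p.2 ^ 2}
  have hA : IsOpen A := e.isOpen_inter_preimage (isOpen_lt (by fun_prop) (by fun_prop))
  have hAK : A ⊆ e.symm '' K := fun q hq => ⟨e q, le_of_lt (b := p.1 ^ 2 + p.2 ^ 2) hq.2, e.left_inv hq.1⟩
  -- The component misses the curve, which is `e.symm '' K` minus `A`. It is therefore covered by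
  -- the disjoint open sets `A` and the complement of `e.symm '' K`; as it contains `0`, it lies in
  -- `A`.
  refine (isPreconnected_connectedComponentIn.subset_left_of_subset_union hA
    hK.isClosed.isOpen_compl (disjoint_compl_right_iff_subset.2 hAK) ?_ ?_).trans hAK
  · intro q hq
    by_contra! hq'
    rw [mem_union, not_or, notMem_compl_iff] at hq'
    obtain ⟨hqA, z, hz, rfl⟩ := hq'
    have hz' : z.1 ^ 2 + z.2 ^ 2 = p.1 ^ 2 + p.2 ^ 2 := by
      refine le_antisymm hz (not_lt.1 fun hlt => hqA ⟨e.map_target (ht hz), ?_⟩)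
      rwa [mem_preimage, e.right_inv (ht hz)]
    obtain ⟨t, rfl⟩ := exists_rot_eq hp hz'
    exact connectedComponentIn_subset _ _ hq ⟨t, rfl⟩
  · exact ⟨0, mem_connectedComponentIn hnot, h0, by simpa [he] using hpos⟩

/-- By the inverse function theorem the linearization is a local homeomorphism at the origin; small
circles pull back to cycles surrounding it. -/
lemma IsLinearizationOn.isCenter (h : IsLinearizationOn V Φ U) : IsCenter V 0 := by
  have hd : HasStrictFDerivAt Φ ((ContinuousLinearEquiv.refl ℝ (ℝ × ℝ) : _ ≃L[ℝ] _) :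
      (ℝ × ℝ) →L[ℝ] (ℝ × ℝ)) 0 := by
    have := (h.analytic 0 h.zero_mem).hasStrictFDerivAt
    rw [h.fderiv_zero] at this
    exact this
  have hUn : ∀ᶠ q in 𝓝[≠] (0 : ℝ × ℝ), q ∈ U :=
    nhdsWithin_le_nhds (h.isOpen.mem_nhds h.zero_mem)
  refine ⟨?_, ?_, ?_⟩
  · have := h.linear 0 h.zero_mem
    rw [h.fderiv_zero, h.map_zero] at this
    simpa [Prod.ext_iff] using this
  · filter_upwards [hUn, self_mem_nhdsWithin] with q hq hq0 hV
    have := h.linear q hq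
    rw [hV, ContinuousLinearMap.map_zero, Prod.ext_iff] at this
    simp only [Prod.fst_zero, Prod.snd_zero, zero_eq_neg] at this
    exact h.ne_zero hq hq0 (Prod.ext this.2.symm this.1)
  set e := hd.toOpenPartialHomeomorph.restrOpen U h.isOpen with he
  have hcoe : ∀ q, e q = Φ q := fun q => rfl
  have hsub : e.source ⊆ U := by
    intro q hq
    rw [he, OpenPartialHomeomorph.restrOpen_source] at hq
    exact hq.2
  have h0 : (0 : ℝ × ℝ) ∈ e.source := by
    rw [he, OpenPartialHomeomorph.restrOpen_source]
    exact ⟨hd.mem_toOpenPartialHomeomorph_source, h.zero_mem⟩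
  have he0 : e 0 = 0 := h.map_zero
  obtain ⟨r, hr, hrt⟩ := exists_disc_subset (e.open_target.mem_nhds (by simpa only [he0] using e.map_source h0))
  have hev : ∀ᶠ q in 𝓝 (0 : ℝ × ℝ), q ∈ e.source ∧ (e q).1 ^ 2 + (e q).2 ^ 2 < r := by
    have h1 : ContinuousAt e 0 := e.continuousAt h0
    have h2 : ContinuousAt (fun q => (e q).1 ^ 2 + (e q).2 ^ 2) 0 :=
      (h1.fst.pow 2).add (h1.snd.pow 2)
    exact Filter.Eventually.and (e.open_source.mem_nhds h0) (h2.eventually_lt_const (by simpa [he0] using hr))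
  filter_upwards [nhdsWithin_le_nhds hev, self_mem_nhdsWithin] with q hq hq0
  have hp : e q ≠ 0 := h.ne_zero (hsub hq.1) hq0
  have ht : ∀ t, rot (e q) t ∈ e.target := fun t => hrt ((rot_sq_add_sq _ t).trans_lt hq.2)
  refine ⟨fun t => e.symm (rot (e q) t), 2 * Real.pi, ⟨?_, Real.two_pi_pos, ?_, ?_⟩, ?_, 0, ?_⟩
  · intro t
    have hU : e.symm (rot (e q) t) ∈ U := hsub (e.map_target (ht t))
    have hder := (h.analytic _ hU).differentiableAt.hasFDerivAt
    have hinv := e.hasFDerivAt_symm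
      (f' := (fderiv ℝ Φ (e.symm (rot (e q) t))).toContinuousLinearEquivOfDetNeZero
        (h.det_ne_zero _ hU)) (ht t) hder
    refine (hinv.comp_hasDerivAt t (hasDerivAt_rot (e q) t)).congr_deriv ?_
    change ContinuousLinearEquiv.symm _ _ = _
    rw [ContinuousLinearEquiv.symm_apply_eq]
    have := h.linear _ hU
    rw [← hcoe, e.right_inv (ht t)] at this
    exact this.symm
  · intro t
    simp only [rot_periodic (e q) t]
  · exact (e.symm.injOn.comp (injOn_rot hp) fun t _ => ht t)
  · exact surrounds_symm_rot e h0 he0 hp fun z hz => hrt (lt_of_le_of_lt hz hq.2)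
  · simp [e.left_inv hq.1]

lemma sign_invariant_of_hasDerivAt {p w : ℝ → ℝ} (hp : Continuous p)
    (hw : ∀ t, HasDerivAt w (p t * w t) t) (s t : ℝ) :
    w t = w s * Real.exp (∫ x in s..t, p x) := by
  have h : ∀ t, HasDerivAt (fun t => w t * Real.exp (-∫ x in s..t, p x)) 0 t := by
    intro t
    have h1 : HasDerivAt (fun t => ∫ x in s..t, p x) (p t) t :=
      intervalIntegral.integral_hasDerivAt_right (hp.intervalIntegrable _ _)
        (hp.stronglyMeasurableAtFilter _ _) hp.continuousAt
    refine ((hw t).mul h1.fun_neg.exp).congr_deriv ?_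
    ring
  have := is_const_of_deriv_eq_zero (fun t => (h t).differentiableAt) (fun t => (h t).deriv) t s
  simp only [intervalIntegral.integral_same, neg_zero, Real.exp_zero, mul_one] at this
  rw [← this, mul_assoc, ← Real.exp_add]
  simp

/-- Such a curve stays on one side of the `y`-axis, so the horizontal ray from the origin to the
other side lies in the complement and makes the component unbounded. -/
lemma not_surrounds_zero_of_fst_ne_zero {γ : ℝ → ℝ × ℝ} (hγ : Continuous γ)
    (h : ∀ t, (γ t).1 ≠ 0) : ¬ Surrounds γ 0 := by
  rintro ⟨h0, hb⟩
  have hs : ∀ t, 0 < (γ 0).1 * (γ t).1 := by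
    intro t
    by_contra! hle
    obtain ⟨s, hs⟩ := mem_range_of_exists_le_of_exists_ge
      (f := fun t => (γ 0).1 * (γ t).1) (by fun_prop) ⟨t, hle⟩ ⟨0, mul_self_nonneg _⟩
    exact mul_ne_zero (h 0) (h s) hs
  have hray : (fun s : ℝ => (-(γ 0).1 * s, (0 : ℝ))) '' Ici 0 ⊆
      connectedComponentIn (range γ)ᶜ 0 := by
    refine IsPreconnected.subset_connectedComponentIn
      (isPreconnected_Ici.image _ (by fun_prop)) ⟨0, self_mem_Ici, by simp⟩ ?_
    rintro _ ⟨s, hs', rfl⟩ ⟨t, ht⟩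
    have h1 := hs t
    rw [ht] at h1
    have hs' : 0 ≤ s := hs'
    nlinarith [mul_nonneg (mul_self_nonneg (γ 0).1) hs']
  obtain ⟨C, hC⟩ := (hb.subset hray).exists_norm_le
  have hpos : 0 < |(γ 0).1| := abs_pos.2 (h 0)
  have hC0 : 0 ≤ |C| + 1 := by positivity
  have := hC _ ⟨(|C| + 1) / |(γ 0).1|, by simp only [mem_Ici]; positivity, rfl⟩
  have h2 := (norm_fst_le _).trans this
  rw [Real.norm_eq_abs, abs_mul, abs_neg, abs_of_nonneg (a := _ / _) (by positivity),
    mul_div_cancel₀ _ hpos.ne'] at h2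
  linarith [le_abs_self C]

/-- The function `a x⁴ - 1` satisfies a linear homogeneous equation along solutions, so it keeps its
sign. If it is ever nonnegative, `x` never vanishes, because its value at `x = 0` is `-1`. -/
lemma lt_one_of_surrounds {a b c : ℝ} {γ : ℝ → ℝ × ℝ}
    (hγ : IsIntegralCurve γ (fun _ => cb5 a b c)) (hs : Surrounds γ 0) (t : ℝ) :
    a * (γ t).1 ^ 4 < 1 := by
  have hcont : Continuous γ := hγ.continuous
  by_contra! hle
  refine not_surrounds_zero_of_fst_ne_zero hcont (fun s hs => ?_) hs
  have hw : ∀ t, HasDerivAt (fun t => a * (γ t).1 ^ 4 - 1)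
      (4 * a * (γ t).1 ^ 3 * (γ t).2 * (a * (γ t).1 ^ 4 - 1)) t := by
    intro t
    refine ((((hasDerivAt_components (hγ t)).1.fun_pow 4).const_mul a).sub_const 1).congr_deriv ?_
    simp only [cb5]
    push_cast
    ring
  have := sign_invariant_of_hasDerivAt (by fun_prop) hw t s
  rw [hs] at this
  have h2 : 0 ≤ (a * (γ t).1 ^ 4 - 1) *
    Real.exp (∫ x in t..s, 4 * a * (γ x).1 ^ 3 * (γ x).2) :=
    mul_nonneg (by linarith) (Real.exp_pos _).le
  rw [← this] at h2
  norm_num at h2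

lemma isIsochronousCenter_of_isLinearizationOn {a b c : ℝ}
    (h : IsLinearizationOn (cb5 a b c) Φ {q | a * q.1 ^ 4 < 1}) :
    IsIsochronousCenter (cb5 a b c) 0 := by
  refine ⟨h.isCenter, 2 * Real.pi, fun γ T hγ hann => h.period_eq hγ fun t => ?_⟩
  rcases connectedComponentIn_subset _ _ (hann ⟨t, rfl⟩) with h0 | ⟨δ, S, hδ, hs, s, hst⟩
  · rw [h0]
    exact h.zero_mem
  · rw [← hst]
    exact lt_one_of_surrounds hδ.isIntegralCurve hs s

end PlanarSystem

/-! ### Rescaled orbits and resonant terms -/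

namespace PlanarSystem

variable {a b c T μ : ℝ} {X Y : ℝ → ℝ}

/-- An orbit of (CB5) through `(r, 0)` which returns after the time `T`, rescaled by `r`, where
`μ = r ^ 4`. -/
structure IsRescaledOrbit (a b c T μ : ℝ) (X Y : ℝ → ℝ) : Prop where
  fst : ∀ t, HasDerivAt X (-Y t + μ * (a * Y t * X t ^ 4)) t
  snd : ∀ t, HasDerivAt Y (X t + μ * (b * X t ^ 3 * Y t ^ 2 + c * X t ^ 5)) t
  fst_zero : X 0 = 1
  snd_zero : Y 0 = 0
  fst_end : X T = 1
  snd_end : Y T = 0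
  pos : ∀ t, 0 < X t ^ 2 + Y t ^ 2

lemma IsIsochronousCenter.exists_orbit {V : ℝ × ℝ → ℝ × ℝ} (h : IsIsochronousCenter V 0) :
    ∃ T : ℝ, ∀ᶠ q in 𝓝[≠] (0 : ℝ × ℝ), 0 < T ∧ ∃ γ : ℝ → ℝ × ℝ,
      IsIntegralCurve γ (fun _ => V) ∧ γ 0 = q ∧ γ T = q ∧ ∀ t, γ t ≠ 0 := by
  obtain ⟨⟨-, -, hc⟩, T, hT⟩ := h
  refine ⟨T, ?_⟩
  obtain ⟨ε, hε, hball⟩ := Metric.mem_nhdsWithin_iff.1 hc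
  have hball' : Metric.ball 0 ε ⊆ insert (0 : ℝ × ℝ) (cyclePoints V 0) := by
    intro q hq
    by_cases h0 : q = 0
    · exact Or.inl h0
    · exact Or.inr (hball ⟨hq, h0⟩)
  filter_upwards [nhdsWithin_le_nhds (Metric.ball_mem_nhds 0 hε), hc] with q hq hcyc
  obtain ⟨γ, S, hγ, hs, t₀, rfl⟩ := hcyc
  have hrange : range γ ⊆ insert 0 (cyclePoints V 0) := fun z hz => Or.inr ⟨γ, S, hγ, hs, hz⟩
  -- The cycle through a point of the ball, joined with the ball, is connected, so it lies in the
  -- period annulus and has the common period.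
  have hconn : IsPreconnected (Metric.ball (0 : ℝ × ℝ) ε ∪ range γ) :=
    IsPreconnected.union (γ t₀) hq ⟨t₀, rfl⟩ (convex_ball _ _).isPreconnected
      (isPreconnected_range hγ.isIntegralCurve.continuous)
  have hsub := hconn.subset_connectedComponentIn (Or.inl (Metric.mem_ball_self hε))
    (union_subset hball' hrange)
  obtain rfl := hT γ S hγ (subset_union_right.trans hsub)
  refine ⟨hγ.pos, fun t => γ (t + t₀), hγ.isIntegralCurve.comp_add t₀, by simp, ?_, ?_⟩
  · simp only
    rw [add_comm, hγ.periodic]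
  · intro t ht
    exact hs.1 ⟨_, ht⟩

lemma isRescaledOrbit_of_isIntegralCurve {r : ℝ} (hr : 0 < r) {γ : ℝ → ℝ × ℝ}
    (hγ : IsIntegralCurve γ (fun _ => cb5 a b c)) (h0 : γ 0 = (r, 0)) (hT : γ T = (r, 0))
    (hne : ∀ t, γ t ≠ 0) :
    IsRescaledOrbit a b c T (r ^ 4) (fun t => (γ t).1 / r) (fun t => (γ t).2 / r) where
  fst t := by
    refine ((hasDerivAt_components (hγ t)).1.div_const r).congr_deriv ?_
    simp only [cb5]
    field_simp
  snd t := by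
    refine ((hasDerivAt_components (hγ t)).2.div_const r).congr_deriv ?_
    simp only [cb5]
    field_simp
    ring
  fst_zero := by simp [h0, hr.ne']
  snd_zero := by simp [h0]
  fst_end := by simp [hT, hr.ne']
  snd_end := by simp [hT]
  pos t := by
    have := sq_add_sq_pos (hne t)
    rw [div_pow, div_pow, ← add_div]
    positivity

lemma IsIsochronousCenter.exists_rescaledOrbit (h : IsIsochronousCenter (cb5 a b c) 0) :
    ∃ T > 0, ∀ᶠ μ in 𝓝[>] (0 : ℝ), ∃ X Y, IsRescaledOrbit a b c T μ X Y := by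
  obtain ⟨T, hT⟩ := h.exists_orbit
  -- The starting point is `(r, 0)` with `r` the fourth root of `μ`.
  have hlim : Tendsto (fun μ : ℝ => (√(√μ), (0 : ℝ))) (𝓝[>] 0) (𝓝[≠] (0 : ℝ × ℝ)) := by
    refine tendsto_nhdsWithin_of_tendsto_nhds_of_eventually_within _ ?_ ?_
    · refine Tendsto.mono_left ?_ nhdsWithin_le_nhds
      have : Continuous fun μ : ℝ => (√(√μ), (0 : ℝ)) := by fun_prop
      exact this.tendsto' _ _ (by simp)
    · filter_upwards [self_mem_nhdsWithin] with μ hμ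
      have hμ : 0 < μ := hμ
      have : √(√μ) ≠ 0 := by positivity
      simpa [Prod.ext_iff] using this
  have hev := hlim.eventually hT
  refine ⟨T, hev.exists.choose_spec.1, ?_⟩
  filter_upwards [hev, self_mem_nhdsWithin] with μ hμ hμ0
  have hμ0 : 0 < μ := hμ0
  obtain ⟨-, γ, hγ, h0, hT, hne⟩ := hμ
  have := isRescaledOrbit_of_isIntegralCurve (by positivity) hγ h0 hT hne
  rw [show √(√μ) ^ 4 = (√(√μ) ^ 2) ^ 2 by ring, Real.sq_sqrt (by positivity),
    Real.sq_sqrt hμ0.le] at this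
  exact ⟨_, _, this⟩

/-- For `N = X² + Y²` one has `N' = 2μE` with `|E| ≤ (|a| + |b| + |c|) N³`. So `N⁻²` has a
derivative bounded independently of `N`, and starting from `1` it stays above `1/2` up to time `T`.
-/
lemma IsRescaledOrbit.sq_add_sq_le (h : IsRescaledOrbit a b c T μ X Y) (hμ : 0 < μ)
    (hsmall : 4 * μ * (|a| + |b| + |c|) * T ≤ 1 / 2) {t : ℝ} (ht : t ∈ Icc 0 T) :
    X t ^ 2 + Y t ^ 2 ≤ 2 := by
  set N : ℝ → ℝ := fun t => X t ^ 2 + Y t ^ 2 with hN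
  set E : ℝ → ℝ := fun t => X t ^ 3 * Y t * ((a + c) * X t ^ 2 + b * Y t ^ 2) with hE
  have hder : ∀ t, HasDerivAt N (2 * μ * E t) t := by
    intro t
    refine (((h.fst t).fun_pow 2).fun_add ((h.snd t).fun_pow 2)).congr_deriv ?_
    simp only [hE]
    push_cast
    ring
  have hbound : ∀ t, |E t| ≤ (|a| + |b| + |c|) * N t ^ 3 := by
    intro t
    have h1 : |X t ^ 3 * Y t| ≤ N t ^ 2 := by
      simp only [hN]
      rw [abs_le]
      constructor <;>
      nlinarith [sq_nonneg (X t ^ 2 + X t * Y t), sq_nonneg (X t ^ 2 - X t * Y t),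
        sq_nonneg (X t * Y t), sq_nonneg (Y t ^ 2), sq_nonneg (X t ^ 2)]
    have h2 : |(a + c) * X t ^ 2 + b * Y t ^ 2| ≤ (|a| + |b| + |c|) * N t := by
      have hX := sq_nonneg (X t)
      have hY := sq_nonneg (Y t)
      calc |(a + c) * X t ^ 2 + b * Y t ^ 2| ≤ |a + c| * X t ^ 2 + |b| * Y t ^ 2 := by
            refine (abs_add_le _ _).trans_eq ?_
            rw [abs_mul, abs_mul, abs_of_nonneg hX, abs_of_nonneg hY]
        _ ≤ (|a| + |c|) * X t ^ 2 + |b| * Y t ^ 2 := by gcongr; exact abs_add_le _ _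
        _ ≤ (|a| + |b| + |c|) * N t := by
            simp only [hN]
            nlinarith [mul_nonneg (abs_nonneg a) hY, mul_nonneg (abs_nonneg c) hY,
              mul_nonneg (abs_nonneg b) hX]
    calc |E t| = |X t ^ 3 * Y t| * |(a + c) * X t ^ 2 + b * Y t ^ 2| := abs_mul _ _
      _ ≤ N t ^ 2 * ((|a| + |b| + |c|) * N t) := by gcongr
      _ = _ := by ring
  have hder' : ∀ t ∈ Icc 0 T,
      HasDerivWithinAt (fun t => (N t ^ 2)⁻¹) (-(2 * N t * (2 * μ * E t)) / (N t ^ 2) ^ 2)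
        (Icc 0 T) t := by
    intro t _
    refine ((((hder t).fun_pow 2).fun_inv (pow_pos (h.pos t) 2).ne').congr_deriv ?_).hasDerivWithinAt
    push_cast
    ring
  have hmv := norm_image_sub_le_of_norm_deriv_le_segment' (C := 4 * μ * (|a| + |b| + |c|)) hder'
    (fun t _ => by
      have hp : 0 < N t := h.pos t
      rw [Real.norm_eq_abs, abs_div, abs_neg, abs_mul, abs_mul (2 * μ), abs_mul 2 (N t),
        abs_mul 2 μ, abs_of_pos hμ, abs_of_pos hp, abs_two, abs_of_pos (by positivity : 0 < (N t ^ 2) ^ 2),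
        div_le_iff₀ (by positivity)]
      nlinarith [mul_le_mul_of_nonneg_left (hbound t) (by positivity : 0 ≤ 4 * μ * N t)]) t ht
  have hN0 : N 0 = 1 := by simp [hN, h.fst_zero, h.snd_zero]
  rw [hN0, Real.norm_eq_abs, sub_zero] at hmv
  have hK : 0 ≤ 4 * μ * (|a| + |b| + |c|) := by positivity
  have h1 : (1 / 2 : ℝ) ≤ (N t ^ 2)⁻¹ := by
    have := (abs_le.1 hmv).1
    have := mul_le_mul_of_nonneg_left ht.2 hK
    norm_num at *
    linarith
  have h2 : N t ^ 2 ≤ 2 := by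
    have hp : 0 < N t := h.pos t
    have := (le_inv_comm₀ (by norm_num) (by positivity)).1 h1
    norm_num at this
    exact this
  change N t ≤ 2
  nlinarith

lemma norm_exp_neg_mul_I (t : ℝ) : ‖Complex.exp (-(t * Complex.I))‖ = 1 := by
  rw [← neg_mul, ← Complex.ofReal_neg, Complex.norm_exp_ofReal_mul_I]

/-- Variation of constants for `p' = -q + r`, `q' = p + s`. -/
lemma norm_exp_mul_sub_le {p q r s : ℝ → ℝ} {κ : ℂ} {C : ℝ}
    (hp : ∀ t, HasDerivAt p (-q t + r t) t) (hq : ∀ t, HasDerivAt q (p t + s t) t)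
    (hC : ∀ t ∈ Icc 0 T, ‖Complex.exp (-(t * Complex.I)) * (r t + s t * Complex.I) - κ‖ ≤ C)
    {t : ℝ} (ht : t ∈ Icc 0 T) :
    ‖Complex.exp (-(t * Complex.I)) * (p t + q t * Complex.I) - (p 0 + q 0 * Complex.I) - κ * t‖
      ≤ C * t := by
  have hder : ∀ t : ℝ, HasDerivAt
      (fun t : ℝ => Complex.exp (-(t * Complex.I)) * (p t + q t * Complex.I) - κ * t)
      (Complex.exp (-(t * Complex.I)) * (r t + s t * Complex.I) - κ) t := by
    intro t
    have h1 := ((hp t).ofReal_comp.fun_add ((hq t).ofReal_comp.mul_const Complex.I))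
    have h2 := (((hasDerivAt_id t).ofReal_comp.mul_const Complex.I).fun_neg).cexp
    refine ((h2.fun_mul h1).fun_sub ((hasDerivAt_id t).ofReal_comp.const_mul κ)).congr_deriv ?_
    simp only [id]
    push_cast
    linear_combination (-Complex.exp (-(t * Complex.I)) * q t) * Complex.I_sq
  have := norm_image_sub_le_of_norm_deriv_le_segment'
    (fun t _ => (hder t).hasDerivWithinAt) (fun t ht => hC t (Ico_subset_Icc_self ht)) t ht
  rw [sub_zero] at this
  refine le_of_eq_of_le ?_ this
  congr 1
  simp
  ring

lemma exists_bound_of_continuous {S : ℝ → ℝ → ℝ → ℝ}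
    (hS : Continuous fun p : ℝ × ℝ × ℝ => S p.1 p.2.1 p.2.2) :
    ∃ C, ∀ μ x y : ℝ, 0 < μ → μ ≤ 1 → x ^ 2 + y ^ 2 ≤ 2 → |S μ x y| ≤ C := by
  obtain ⟨C, hC⟩ := (isCompact_Icc (a := (0 : ℝ)) (b := 1)).prod (isCompact_disc 2)
    |>.exists_bound_of_continuousOn hS.continuousOn
  exact ⟨C, fun μ x y h0 h1 h => hC (μ, x, y) ⟨⟨h0.le, h1⟩, h⟩⟩

lemma norm_ofReal_add_ofReal_mul_I_le (x y : ℝ) : ‖(x + y * Complex.I : ℂ)‖ ≤ |x| + |y| := by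
  refine (norm_add_le _ _).trans_eq ?_
  simp

/-- Along the rescaled orbits, `exp (-it) (X + iY) = 1 + O(μ)`. -/
lemma exists_norm_exp_mul_sub_one_le
    (hev : ∀ᶠ μ in 𝓝[>] (0 : ℝ), ∃ X Y, IsRescaledOrbit a b c T μ X Y) :
    ∃ C, ∀ᶠ μ in 𝓝[>] (0 : ℝ), ∃ X Y, IsRescaledOrbit a b c T μ X Y ∧ ∀ t ∈ Icc 0 T,
      X t ^ 2 + Y t ^ 2 ≤ 2 ∧
      ‖Complex.exp (-(t * Complex.I)) * (X t + Y t * Complex.I) - 1‖ ≤ C * μ := by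
  obtain ⟨C₁, hC₁⟩ := exists_bound_of_continuous (S := fun _ x y => a * y * x ^ 4) (by fun_prop)
  obtain ⟨C₂, hC₂⟩ := exists_bound_of_continuous
    (S := fun _ x y => b * x ^ 3 * y ^ 2 + c * x ^ 5) (by fun_prop)
  refine ⟨(C₁ + C₂) * T, ?_⟩
  have hsmall : ∀ᶠ μ in 𝓝[>] (0 : ℝ), 4 * μ * (|a| + |b| + |c|) * T < 1 / 2 := by
    refine nhdsWithin_le_nhds ?_
    exact (Continuous.tendsto (by fun_prop) (0 : ℝ)).eventually_lt_const (by simp)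
  have hone : ∀ᶠ μ in 𝓝[>] (0 : ℝ), μ < 1 := nhdsWithin_le_nhds (gt_mem_nhds one_pos)
  filter_upwards [hev, hsmall, hone, self_mem_nhdsWithin] with μ ⟨X, Y, h⟩ hμs hμ1 hμ0
  have hμ0 : 0 < μ := hμ0
  have hle := fun t ht => h.sq_add_sq_le hμ0 hμs.le (t := t) ht
  refine ⟨X, Y, h, fun t ht => ⟨hle t ht, ?_⟩⟩
  have := norm_exp_mul_sub_le (κ := 0) (C := μ * (C₁ + C₂)) h.fst h.snd (fun t ht => by
    rw [sub_zero, norm_mul, norm_exp_neg_mul_I, one_mul]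
    refine (norm_ofReal_add_ofReal_mul_I_le _ _).trans ?_
    rw [abs_mul μ, abs_mul μ, abs_of_pos hμ0, ← mul_add]
    gcongr
    · exact hC₁ μ _ _ hμ0 hμ1.le (hle t ht)
    · exact hC₂ μ _ _ hμ0 hμ1.le (hle t ht)) ht
  rw [h.fst_zero, h.snd_zero] at this
  simp only [Complex.ofReal_one, Complex.ofReal_zero, zero_mul, add_zero, sub_zero] at this
  refine this.trans ?_
  have h0 : 0 ≤ C₁ + C₂ := by
    have h1 := (abs_nonneg _).trans (hC₁ μ 0 0 hμ0 hμ1.le (by norm_num))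
    have h2 := (abs_nonneg _).trans (hC₂ μ 0 0 hμ0 hμ1.le (by norm_num))
    exact add_nonneg h1 h2
  nlinarith [mul_le_mul_of_nonneg_left ht.2 (mul_nonneg hμ0.le h0)]

lemma eq_zero_of_eventually_norm_le {E : Type*} [NormedAddCommGroup E] {z : E} {C : ℝ}
    (h : ∀ᶠ μ in 𝓝[>] (0 : ℝ), ‖z‖ ≤ C * μ) : z = 0 := by
  have h1 : Tendsto (fun μ : ℝ => C * μ) (𝓝[>] 0) (𝓝 0) := by
    refine Tendsto.mono_left ?_ nhdsWithin_le_nhds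
    exact Continuous.tendsto' (by fun_prop) _ _ (by simp)
  exact norm_le_zero_iff.1 (ge_of_tendsto h1 h)

/-- At `t = T` the orbit is back at `1`; the estimate then holds for a quantity independent of `μ`,
and `μ → 0` forces equality. -/
lemma exp_neg_mul_I_eq_one (hT : 0 < T)
    (hev : ∀ᶠ μ in 𝓝[>] (0 : ℝ), ∃ X Y, IsRescaledOrbit a b c T μ X Y) :
    Complex.exp (-(T * Complex.I)) = 1 := by
  obtain ⟨C, hC⟩ := exists_norm_exp_mul_sub_one_le hev
  refine sub_eq_zero.1 (eq_zero_of_eventually_norm_le (C := C) ?_)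
  filter_upwards [hC] with μ ⟨X, Y, h, hb⟩
  simpa [h.fst_end, h.snd_end] using (hb T ⟨hT.le, le_rfl⟩).2

/-- Used with `w = exp (-it)` and `z = X + iY`: in the rotating frame the resonant term is constant
up to `O(μ)`, since `|z|` is also within `ε` of `1`. -/
lemma norm_pow_mul_sub_one_le {w z : ℂ} {N ε : ℝ} (j : ℕ) (hN : N ≤ 2) (hz : ‖z‖ ^ 2 = N)
    (hw : ‖w‖ = 1) (h : ‖w * z - 1‖ ≤ ε) :
    ‖w * (N ^ j * z) - 1‖ ≤ (2 ^ j + j * 2 ^ j * 3) * ε := by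
  have hε : 0 ≤ ε := (norm_nonneg _).trans h
  have hN0 : 0 ≤ N := hz ▸ sq_nonneg _
  have h1 : |‖z‖ - 1| ≤ ε := by
    have := abs_norm_sub_norm_le (w * z) 1
    rw [norm_mul, hw, one_mul, norm_one] at this
    exact this.trans h
  have hz2 : ‖z‖ ≤ 2 := by nlinarith [norm_nonneg z]
  have h2 : |N - 1| ≤ 3 * ε := by
    rw [← hz, show ‖z‖ ^ 2 - 1 = (‖z‖ + 1) * (‖z‖ - 1) by ring, abs_mul]
    gcongr
    rw [abs_of_nonneg (by positivity)]
    linarith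
  have h3 : ∀ j : ℕ, |N ^ j - 1| ≤ j * 2 ^ j * (3 * ε) := by
    intro j
    induction j with
    | zero => simp
    | succ j ih =>
      have hp : N ^ j ≤ 2 ^ j := by gcongr
      calc |N ^ (j + 1) - 1| = |N ^ j * (N - 1) + (N ^ j - 1)| := by congr 1; ring
        _ ≤ N ^ j * |N - 1| + |N ^ j - 1| := by
            refine (abs_add_le _ _).trans_eq ?_
            rw [abs_mul, abs_of_nonneg (by positivity : 0 ≤ N ^ j)]
        _ ≤ 2 ^ j * (3 * ε) + j * 2 ^ j * (3 * ε) := by gcongr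
        _ ≤ ((j + 1 : ℕ) : ℝ) * 2 ^ (j + 1) * (3 * ε) := by
            have : 0 ≤ (j + 1 : ℝ) * (2 ^ j * (3 * ε)) := by positivity
            push_cast
            rw [pow_succ]
            nlinarith
  calc ‖w * (N ^ j * z) - 1‖ = ‖(N : ℂ) ^ j * (w * z - 1) + ((N ^ j - 1 : ℝ) : ℂ)‖ := by
        congr 1
        push_cast
        ring
    _ ≤ N ^ j * ‖w * z - 1‖ + |N ^ j - 1| := by
        refine (norm_add_le _ _).trans_eq ?_
        rw [norm_mul, norm_pow, Complex.norm_real, Complex.norm_real, Real.norm_eq_abs,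
          Real.norm_eq_abs, abs_of_nonneg hN0]
    _ ≤ 2 ^ j * ε + j * 2 ^ j * (3 * ε) := by
        gcongr
        exact h3 j
    _ = _ := by ring

/-- If near-identity coordinates `p + iq` bring the system into a normal form with leading
resonant term `iα |z|^(2j) z`, then isochronicity forces `α = 0`. -/
lemma resonant_coeff_eq_zero (hT : 0 < T)
    (hev : ∀ᶠ μ in 𝓝[>] (0 : ℝ), ∃ X Y, IsRescaledOrbit a b c T μ X Y)
    {p q S₁ S₂ : ℝ → ℝ → ℝ → ℝ} {α : ℝ} (j m : ℕ)
    (hS₁ : Continuous fun u : ℝ × ℝ × ℝ => S₁ u.1 u.2.1 u.2.2)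
    (hS₂ : Continuous fun u : ℝ × ℝ × ℝ => S₂ u.1 u.2.1 u.2.2)
    (hp : ∀ μ X Y, IsRescaledOrbit a b c T μ X Y → ∀ t,
      HasDerivAt (fun t => p μ (X t) (Y t)) (-q μ (X t) (Y t) +
        μ ^ m * (-α * (X t ^ 2 + Y t ^ 2) ^ j * Y t + μ * S₁ μ (X t) (Y t))) t)
    (hq : ∀ μ X Y, IsRescaledOrbit a b c T μ X Y → ∀ t,
      HasDerivAt (fun t => q μ (X t) (Y t)) (p μ (X t) (Y t) +
        μ ^ m * (α * (X t ^ 2 + Y t ^ 2) ^ j * X t + μ * S₂ μ (X t) (Y t))) t) :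
    α = 0 := by
  obtain ⟨C, hC⟩ := exists_norm_exp_mul_sub_one_le hev
  obtain ⟨C₁, hC₁⟩ := exists_bound_of_continuous hS₁
  obtain ⟨C₂, hC₂⟩ := exists_bound_of_continuous hS₂
  have hexp := exp_neg_mul_I_eq_one hT hev
  have hone : ∀ᶠ μ in 𝓝[>] (0 : ℝ), μ < 1 := nhdsWithin_le_nhds (gt_mem_nhds one_pos)
  set D := |α| * ((2 ^ j + j * 2 ^ j * 3) * C) + (C₁ + C₂)
  refine eq_zero_of_eventually_norm_le (C := D) ?_
  filter_upwards [hC, hone, self_mem_nhdsWithin] with μ ⟨X, Y, h, hb⟩ hμ1 hμ0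
  have hμ0 : 0 < μ := hμ0
  have key := norm_exp_mul_sub_le (κ := μ ^ m * (α * Complex.I)) (C := μ ^ m * (D * μ))
    (hp μ X Y h) (hq μ X Y h) (fun t ht => by
      obtain ⟨hle, happ⟩ := hb t ht
      have hsq : ‖(X t + Y t * Complex.I : ℂ)‖ ^ 2 = X t ^ 2 + Y t ^ 2 := by
        rw [← Complex.normSq_eq_norm_sq, Complex.normSq_add_mul_I]
      have h1 := norm_pow_mul_sub_one_le j hle hsq (norm_exp_neg_mul_I t) happ
      have h2 := norm_ofReal_add_ofReal_mul_I_le (S₁ μ (X t) (Y t)) (S₂ μ (X t) (Y t))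
      have h3 := hC₁ μ _ _ hμ0 hμ1.le hle
      have h4 := hC₂ μ _ _ hμ0 hμ1.le hle
      set e := Complex.exp (-(t * Complex.I))
      have he : ‖e‖ = 1 := norm_exp_neg_mul_I t
      set N := X t ^ 2 + Y t ^ 2
      calc _ = ‖(μ : ℂ) ^ m * ((α * Complex.I) * (e * (N ^ j * (X t + Y t * Complex.I)) - 1) +
              μ * (e * (S₁ μ (X t) (Y t) + S₂ μ (X t) (Y t) * Complex.I)))‖ := by
            congr 1
            push_cast
            linear_combination (-(μ : ℂ) ^ m * α * e * N ^ j * Y t) * Complex.I_sq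
        _ ≤ μ ^ m * (|α| * ((2 ^ j + j * 2 ^ j * 3) * (C * μ)) + μ * (C₁ + C₂)) := by
            rw [norm_mul, norm_pow, Complex.norm_real, Real.norm_eq_abs, abs_of_pos hμ0]
            gcongr
            refine (norm_add_le _ _).trans (add_le_add ?_ ?_)
            · rw [norm_mul, norm_mul, Complex.norm_I, mul_one, Complex.norm_real,
                Real.norm_eq_abs]
              gcongr
            · rw [norm_mul, norm_mul, he, one_mul, Complex.norm_real, Real.norm_eq_abs,
                abs_of_pos hμ0]
              gcongr
              linarith
        _ = μ ^ m * (D * μ) := by ring) (t := T) ⟨hT.le, le_rfl⟩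
  -- The return at time `T` cancels the endpoint terms and leaves only the drift: `μ^m |α| T ≤ μ^m D
  -- μ T`.
  rw [hexp, one_mul, h.fst_end, h.snd_end, h.fst_zero, h.snd_zero, sub_self, zero_sub, norm_neg,
    norm_mul, norm_mul, norm_mul, norm_pow, Complex.norm_I, Complex.norm_real, Complex.norm_real,
    Complex.norm_real, mul_one, Real.norm_of_nonneg hμ0.le, Real.norm_of_nonneg hT.le] at key
  have hμm : 0 < μ ^ m := by positivity
  exact le_of_mul_le_mul_left (le_of_mul_le_mul_right key hT) hμm

end PlanarSystem

/-! ### The two period constants -/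

namespace PlanarSystem

/-- A quintic form which is even in `y`. -/
noncomputable def quintic (k₀ k₁ k₂ x y : ℝ) : ℝ :=
  k₀ * x ^ 5 + k₁ * (x ^ 3 * y ^ 2) + k₂ * (x * y ^ 4)

/-- The partial derivative of `quintic` with respect to `x`. -/
noncomputable def quinticX (k₀ k₁ k₂ x y : ℝ) : ℝ :=
  5 * k₀ * x ^ 4 + 3 * k₁ * x ^ 2 * y ^ 2 + k₂ * y ^ 4

/-- The partial derivative of `quintic` with respect to `y`. -/
noncomputable def quinticY (k₁ k₂ x y : ℝ) : ℝ :=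
  2 * k₁ * x ^ 3 * y + 4 * k₂ * x * y ^ 3

/-- A form of degree nine which is even in `y`. -/
noncomputable def nonic (k₀ k₁ k₂ k₃ k₄ x y : ℝ) : ℝ :=
  k₀ * x ^ 9 + k₁ * (x ^ 7 * y ^ 2) + k₂ * (x ^ 5 * y ^ 4) + k₃ * (x ^ 3 * y ^ 6) +
    k₄ * (x * y ^ 8)

/-- The partial derivative of `nonic` with respect to `x`. -/
noncomputable def nonicX (k₀ k₁ k₂ k₃ k₄ x y : ℝ) : ℝ :=
  9 * k₀ * x ^ 8 + 7 * k₁ * x ^ 6 * y ^ 2 + 5 * k₂ * x ^ 4 * y ^ 4 + 3 * k₃ * x ^ 2 * y ^ 6 +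
    k₄ * y ^ 8

/-- The partial derivative of `nonic` with respect to `y`. -/
noncomputable def nonicY (k₁ k₂ k₃ k₄ x y : ℝ) : ℝ :=
  2 * k₁ * x ^ 7 * y + 4 * k₂ * x ^ 5 * y ^ 3 + 6 * k₃ * x ^ 3 * y ^ 5 + 8 * k₄ * x * y ^ 7

variable {a b c T : ℝ} {X Y : ℝ → ℝ} {X' Y' t : ℝ}

lemma hasDerivAt_quintic (k₀ k₁ k₂ : ℝ) (hX : HasDerivAt X X' t) (hY : HasDerivAt Y Y' t) :
    HasDerivAt (fun t => quintic k₀ k₁ k₂ (X t) (Y t))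
      (quinticX k₀ k₁ k₂ (X t) (Y t) * X' + quinticY k₁ k₂ (X t) (Y t) * Y') t := by
  refine ((((hX.fun_pow 5).const_mul k₀).fun_add
    (((hX.fun_pow 3).fun_mul (hY.fun_pow 2)).const_mul k₁)).fun_add
    ((hX.fun_mul (hY.fun_pow 4)).const_mul k₂)).congr_deriv ?_
  simp only [quinticX, quinticY]
  push_cast
  ring

lemma hasDerivAt_nonic (k₀ k₁ k₂ k₃ k₄ : ℝ) (hX : HasDerivAt X X' t) (hY : HasDerivAt Y Y' t) :
    HasDerivAt (fun t => nonic k₀ k₁ k₂ k₃ k₄ (X t) (Y t))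
      (nonicX k₀ k₁ k₂ k₃ k₄ (X t) (Y t) * X' + nonicY k₁ k₂ k₃ k₄ (X t) (Y t) * Y') t := by
  refine ((((((hX.fun_pow 9).const_mul k₀).fun_add
    (((hX.fun_pow 7).fun_mul (hY.fun_pow 2)).const_mul k₁)).fun_add
    (((hX.fun_pow 5).fun_mul (hY.fun_pow 4)).const_mul k₂)).fun_add
    (((hX.fun_pow 3).fun_mul (hY.fun_pow 6)).const_mul k₃)).fun_add
    ((hX.fun_mul (hY.fun_pow 8)).const_mul k₄)).congr_deriv ?_
  simp only [nonicX, nonicY]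
  push_cast
  ring

/-- The first period constant vanishes. -/
lemma eq_sub_of_eventually_isRescaledOrbit (hT : 0 < T)
    (hev : ∀ᶠ μ in 𝓝[>] (0 : ℝ), ∃ X Y, IsRescaledOrbit a b c T μ X Y) : b = a - 5 * c := by
  suffices h : (b - a + 5 * c) / 16 = 0 by linarith
  -- The coefficients solve the linear equations that leave only `α |z|⁴ (-y, x)` at order `μ`. The
  -- number `α` is the mean of `(b - a) cos⁴ sin² + c cos⁶`. Reversibility under `(y, t) ↦ (-y, -t)`
  -- allows `p` even and `q` odd in `y`; hence the swapped arguments of `quintic` in `q`.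
  set k₀ := (11 * a + 4 * b + 11 * c) / 96 with hk₀
  set k₁ := (-10 * a + b + 20 * c) / 48 with hk₁
  set k₂ := (-11 * a + 2 * b + 25 * c) / 96 with hk₂
  set l₀ := (-5 * a - 4 * b - 5 * c) / 96 with hl₀
  set l₁ := (-2 * a - 7 * b - 20 * c) / 48 with hl₁
  set l₂ := (5 * a + 10 * b - 55 * c) / 96 with hl₂
  refine resonant_coeff_eq_zero hT hev 2 1
    (p := fun μ x y => x + μ * quintic k₀ k₁ k₂ x y)
    (q := fun μ x y => y + μ * quintic l₀ l₁ l₂ y x)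
    (S₁ := fun _ x y => quinticX k₀ k₁ k₂ x y * (a * y * x ^ 4) +
      quinticY k₁ k₂ x y * (b * x ^ 3 * y ^ 2 + c * x ^ 5))
    (S₂ := fun _ x y => quinticX l₀ l₁ l₂ y x * (b * x ^ 3 * y ^ 2 + c * x ^ 5) +
      quinticY l₁ l₂ y x * (a * y * x ^ 4)) ?_ ?_ ?_ ?_
  · simp only [quinticX, quinticY]
    fun_prop
  · simp only [quinticX, quinticY]
    fun_prop
  · intro μ X Y h t
    refine ((h.fst t).fun_add
      ((hasDerivAt_quintic k₀ k₁ k₂ (h.fst t) (h.snd t)).const_mul μ)).congr_deriv ?_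
    simp only [quintic, quinticX, quinticY, hk₀, hk₁, hk₂, hl₀, hl₁, hl₂]
    ring
  · intro μ X Y h t
    refine ((h.snd t).fun_add
      ((hasDerivAt_quintic l₀ l₁ l₂ (h.snd t) (h.fst t)).const_mul μ)).congr_deriv ?_
    simp only [quintic, quinticX, quinticY, hk₀, hk₁, hk₂, hl₀, hl₁, hl₂]
    ring

/-- The second period constant vanishes. -/
lemma mul_eq_zero_of_eventually_isRescaledOrbit (hT : 0 < T)
    (hev : ∀ᶠ μ in 𝓝[>] (0 : ℝ), ∃ X Y, IsRescaledOrbit a (a - 5 * c) c T μ X Y) :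
    c * (4 * a + 5 * c) = 0 := by
  suffices h : -7 / 256 * (c * (4 * a + 5 * c)) = 0 by linarith
  -- The quintic coefficients are the previous ones at `b = a - 5c`, where `l₀ = k₂` and `l₁ = k₁`.
  -- The coefficients of degree nine solve the equations at order `μ²`, leaving only the resonant
  -- term `α |z|⁸ (-y, x)`.
  set k₀ := (5 * a - 3 * c) / 32 with hk₀
  set k₁ := (-3 * a + 5 * c) / 16 with hk₁
  set k₂ := (-3 * a + 5 * c) / 32 with hk₂
  set l₂ := (5 * a - 35 * c) / 32 with hl₂
  set m₀ := (825 * a ^ 2 - 514 * a * c - 1455 * c ^ 2) / 20480 with hm₀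
  set m₁ := (-1175 * a ^ 2 + 2606 * a * c - 5155 * c ^ 2) / 5120 with hm₁
  set m₂ := (-3375 * a ^ 2 - 4466 * a * c - 28495 * c ^ 2) / 30720 with hm₂
  set m₃ := (75 * a ^ 2 - 9238 * a * c - 1985 * c ^ 2) / 15360 with hm₃
  set m₄ := (25 * a ^ 2 - 3266 * a * c - 895 * c ^ 2) / 20480 with hm₄
  set n₀ := (25 * a ^ 2 - 1026 * a * c + 1905 * c ^ 2) / 20480 with hn₀
  set n₁ := (25 * a ^ 2 - 466 * a * c + 2605 * c ^ 2) / 5120 with hn₁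
  set n₂ := (-3375 * a ^ 2 + 27086 * a * c + 2545 * c ^ 2) / 30720 with hn₂
  set n₃ := (-3525 * a ^ 2 + 23338 * a * c - 4465 * c ^ 2) / 15360 with hn₃
  set n₄ := (825 * a ^ 2 - 5954 * a * c + 18145 * c ^ 2) / 20480 with hn₄
  refine resonant_coeff_eq_zero hT hev 4 2
    (p := fun μ x y => x + μ * quintic k₀ k₁ k₂ x y + μ ^ 2 * nonic m₀ m₁ m₂ m₃ m₄ x y)
    (q := fun μ x y => y + μ * quintic k₂ k₁ l₂ y x + μ ^ 2 * nonic n₀ n₁ n₂ n₃ n₄ y x)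
    (S₁ := fun _ x y => nonicX m₀ m₁ m₂ m₃ m₄ x y * (a * y * x ^ 4) +
      nonicY m₁ m₂ m₃ m₄ x y * ((a - 5 * c) * x ^ 3 * y ^ 2 + c * x ^ 5))
    (S₂ := fun _ x y => nonicX n₀ n₁ n₂ n₃ n₄ y x * ((a - 5 * c) * x ^ 3 * y ^ 2 + c * x ^ 5) +
      nonicY n₁ n₂ n₃ n₄ y x * (a * y * x ^ 4)) ?_ ?_ ?_ ?_
  · simp only [nonicX, nonicY]
    fun_prop
  · simp only [nonicX, nonicY]
    fun_prop
  · intro μ X Y h t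
    refine (((h.fst t).fun_add
      ((hasDerivAt_quintic k₀ k₁ k₂ (h.fst t) (h.snd t)).const_mul μ)).fun_add
      ((hasDerivAt_nonic m₀ m₁ m₂ m₃ m₄ (h.fst t) (h.snd t)).const_mul (μ ^ 2))).congr_deriv ?_
    simp only [quintic, quinticX, quinticY, nonic, nonicX, nonicY, hk₀, hk₁, hk₂, hl₂, hm₀, hm₁,
      hm₂, hm₃, hm₄, hn₀, hn₁, hn₂, hn₃, hn₄]
    ring
  · intro μ X Y h t
    refine (((h.snd t).fun_add
      ((hasDerivAt_quintic k₂ k₁ l₂ (h.snd t) (h.fst t)).const_mul μ)).fun_add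
      ((hasDerivAt_nonic n₀ n₁ n₂ n₃ n₄ (h.snd t) (h.fst t)).const_mul (μ ^ 2))).congr_deriv ?_
    simp only [quintic, quinticX, quinticY, nonic, nonicX, nonicY, hk₀, hk₁, hk₂, hl₂, hm₀, hm₁,
      hm₂, hm₃, hm₄, hn₀, hn₁, hn₂, hn₃, hn₄]
    ring

theorem isIsochronousCenter_cb5_iff (a b c : ℝ) : IsIsochronousCenter (cb5 a b c) 0 ↔
    (b = 5 * a ∧ c = -(4 / 5) * a) ∨ (b = a ∧ c = 0) := by
  constructor
  · intro h
    obtain ⟨T, hT, hev⟩ := h.exists_rescaledOrbit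
    obtain rfl := eq_sub_of_eventually_isRescaledOrbit hT hev
    rcases mul_eq_zero.1 (mul_eq_zero_of_eventually_isRescaledOrbit hT hev) with hc | hc
    · exact Or.inr ⟨by rw [hc]; ring, hc⟩
    · exact Or.inl ⟨by linarith, by linarith⟩
  · rintro (⟨rfl, rfl⟩ | ⟨rfl, rfl⟩)
    · exact isIsochronousCenter_of_isLinearizationOn (isLinearizationOn_linearization₁ a)
    · exact isIsochronousCenter_of_isLinearizationOn (isLinearizationOn_linearization₂ b)

end PlanarSystem

theorem mainTheorem3 :
    (∀ a b c : ℝ, IsIsochronousCenter (cb5 a b c) 0 ↔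
      (b = 5 * a ∧ c = -(4 / 5) * a) ∨ (b = a ∧ c = 0)) ∧
    (∀ a : ℝ,
      (IsUrabeFunctionCB5 a (5 * a) (-(4 / 5) * a) (fun _ => 0) ∧
        ∀ h, IsUrabeFunctionCB5 a (5 * a) (-(4 / 5) * a) h → ∀ᶠ t in 𝓝 (0 : ℝ), h t = 0) ∧
      IsFirstIntegralOn (cb5 a (5 * a) (-(4 / 5) * a)) (firstIntegral₁ a)
        {q | a * q.1 ^ 4 ≠ 1} ∧
      IsLinearizationOn (cb5 a (5 * a) (-(4 / 5) * a)) (linearization₁ a)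
        {q | a * q.1 ^ 4 < 1}) ∧
    (∀ a : ℝ,
      (IsUrabeFunctionCB5 a a 0 (fun _ => 0) ∧
        ∀ h, IsUrabeFunctionCB5 a a 0 h → ∀ᶠ t in 𝓝 (0 : ℝ), h t = 0) ∧
      IsFirstIntegralOn (cb5 a a 0) (firstIntegral₂ a) {q | a * q.1 ^ 4 ≠ 1} ∧
      IsLinearizationOn (cb5 a a 0) (linearization₂ a) {q | a * q.1 ^ 4 < 1}) := by
  refine ⟨isIsochronousCenter_cb5_iff, fun a => ⟨?_, ?_, isLinearizationOn_linearization₁ a⟩,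
    fun a => ⟨?_, ?_, isLinearizationOn_linearization₂ a⟩⟩
  · have hc : 5 * (-(4 / 5) * a) = (1 - 5) * a := by ring
    have hk : (5 - 5) * a * (-(4 / 5) * a) = 0 := by ring
    exact ⟨isUrabeFunctionCB5_zero hc hk, fun h => eventually_eq_zero_of_isUrabeFunctionCB5 hc hk⟩
  · rw [firstIntegral₁_eq]
    exact isFirstIntegralOn_firstIntegral (n := 5) (by norm_num) (by push_cast; ring)
      (by push_cast; ring)
  · have hc : 5 * 0 = (1 - 1) * a := by ring
    have hk : (1 - 5) * a * 0 = 0 := by ring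
    have h1 := isUrabeFunctionCB5_zero hc hk
    have h2 := fun h => eventually_eq_zero_of_isUrabeFunctionCB5 (h := h) hc hk
    rw [one_mul] at h1
    simp only [one_mul] at h2
    exact ⟨h1, h2⟩
  · rw [firstIntegral₂_eq]
    simpa using isFirstIntegralOn_firstIntegral (a := a) (c := 0) (n := 1) (by norm_num)
      (by simp) (by simp)
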